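/- **Notation.** Let $A(s)=\sum_{j=0}^{q}A_{j+1}s^j\in\mathbb C[s]^{m\times n}$ ($n\ge1$), $M(s)=\sum_{j=0}^{m_q}M_{j+1}s^j\in\mathbb C[s]^{m\times m}$ and $N(s)=\sum_{j=0}^{n_q}N_{j+1}s^j\in\mathbb C[s]^{n\times n}$. The symbol $*$ denotes conjugate transposition, where $s$ is treated as a real variable (only coefficients are conjugated). Assume $M(s)$ and $N(s)$ are positive definite; it suffices that each of the two is a positive definite Hermitian matrix for infinitely many real values of $s$. For $1\le i\le n$ let $a_i(s)=\sum_{j=0}^q a_{i,j+1}s^j$ be the $i$-th column of $A(s)$, $\widehat A_i(s)=\sum_{j=0}^q\widehat A_{i,j+1}s^j$ the matrix of its first $i$ columns, and $N_i(s)$ the leading principal submatrix of order $i$ of $N(s)$, with coefficients $N_{i,j+1}$; for $i\ge2$ write $$N_i(s)=\begin{bmatrix}N_{i-1}(s)&l_i(s)\\ l_i^*(s)&n_{ii}(s)\end{bmatrix},\quad n_{ii}(s)=\sum_{j=0}^{n_q}\widehat n_{i,j+1}s^j,\quad l_i(s)=\sum_{j=0}^{n_q}L_{i,j+1}s^j,\quad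 N_{i-1}^{-1}(s)=\frac{\sum_{j=0}^{\overline n_q}\overline N_{i-1,j+1}s^j}{\sum_{j=0}^{\overline{\overline n}_q}\overline{\overline N}_{i-1,j+1}s^j},$$ the last being any such representation with a nonzero scalar denominator with real coefficients ($\overline n_q,\overline{\overline n}_q$ may depend on $i$). For a rational matrix $B(s)$ with $k$ columns and weights $M(s)$ and $K(s)$ of orders $m$ and $k$, the weighted Moore-Penrose inverse $B^\dagger_{M,K}$ is the unique matrix $X$ over $\mathbb C(s)$ with $BXB=B$, $XBX=X$, $(MBX)^*=MBX$, $(KXB)^*=KXB$. **Algorithm.** Coefficients outside the stated ranges are zero; $I_{i-1,1}=I$ and $I_{i-1,j+1}=0$ for $j\ge1$. In multiple sums all indices are nonnegative integers. *Step 1.* Put $q_1=q+m_q$, $p_1=2q+m_q$. If $a_1(s)\neq0$, let $$Z_{1,j+1}=\sum_{k=0}^{j}a_{1,j-k+1}^*M_{k+1}\ (0\le j\le q_1),\qquad Y_{1,j+1}=\sum_{r=0}^{j}\sum_{k=0}^{j-r}a_{1,j-k-r+1}^*M_{k+1}a_{1,r+1}\ (0\le j\le p_1).$$ If $a_1(s)=0$,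 let $Z_{1,j+1}=0$ for all $j$, $Y_{1,1}=1$ and $Y_{1,j+1}=0$ for $j\ge1$. *Step 2.* For $i=2,\dots,n$ put $\hat q_{i-1}=\max\{p_{i-1},q_{i-1}+q\}$ and compute $$d_{i,j+1}=\sum_{k=0}^{j}Z_{i-1,j-k+1}a_{i,k+1}\quad(0\le j\le q_{i-1}+q),$$ $$c_{i,j+1}=\sum_{k=0}^{j}\bigl(a_{i,j-k+1}Y_{i-1,k+1}-\widehat A_{i-1,j-k+1}d_{i,k+1}\bigr)\quad(0\le j\le\hat q_{i-1}+q),$$ $$\varphi_{i,j+1}=\sum_{t=0}^{j}\sum_{r=0}^{j-t}\sum_{k=0}^{j-t-r}\bigl(Y_{i-1,j-k-r-t+1}I_{i-1,k+1}-Z_{i-1,j-k-r-t+1}\widehat A_{i-1,k+1}\bigr)\overline N_{i-1,r+1}L_{i,t+1}\quad(0\le j\le\hat q_{i-1}+\overline n_q+n_q),$$ $$\psi_{i,j+1}=\sum_{k=0}^{j}Y_{i-1,j-k+1}\overline{\overline N}_{i-1,k+1}\quad(0\le j\le p_{i-1}+\overline{\overline n}_q).$$ If some $c_{i,j+1}\neq0$,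 put $\overline b_i=\hat q_{i-1}+q+p_{i-1}+m_q$, $\overline{\overline b}_i=2\hat q_{i-1}+2q+m_q$ and $$V_{i,j+1}=\sum_{r=0}^{j}\sum_{k=0}^{j-r}Y_{i-1,j-k-r+1}c_{i,k+1}^*M_{r+1}\ (0\le j\le\overline b_i),\qquad W_{i,j+1}=\sum_{r=0}^{j}\sum_{k=0}^{j-r}c_{i,j-k-r+1}^*M_{k+1}c_{i,r+1}\ (0\le j\le\overline{\overline b}_i).$$ If all $c_{i,j+1}=0$, put $$\overline\Delta_{i,j+1}=\sum_{r=0}^{j}\sum_{k=0}^{j-r}Y_{i-1,j-k-r+1}Y_{i-1,k+1}\overline{\overline N}_{i-1,r+1}\quad(0\le j\le2p_{i-1}+\overline{\overline n}_q),$$ $$\begin{aligned}\overline{\overline\Delta}_{i,j+1}={}&\sum_{t=0}^{j}\sum_{r=0}^{j-t}\sum_{k=0}^{j-t-r}\bigl(\widehat n_{i,j-k-r-t+1}Y_{i-1,k+1}Y_{i-1,r+1}+d_{i,j-k-r-t+1}^*N_{i-1,k+1}d_{i,r+1}\\&\quad-d_{i,j-k-r-t+1}^*L_{i,k+1}Y_{i-1,r+1}-L_{i,j-k-r-t+1}^*d_{i,k+1}Y_{i-1,r+1}\bigr)\overline{\overline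 N}_{i-1,t+1}\\&-\sum_{r=0}^{j}\sum_{k=0}^{j-r}L_{i,j-k-r+1}^*\varphi_{i,k+1}Y_{i-1,r+1}\end{aligned}$$ for $0\le j\le2\hat q_{i-1}+n_q+\max\{n_q+\overline n_q,\overline{\overline n}_q\}$, and, with $\overline b_i=2p_{i-1}+\overline{\overline n}_q+q_{i-1}+\hat q_{i-1}+n_q$ and $\overline{\overline b}_i=2\hat q_{i-1}+n_q+\max\{n_q+\overline n_q,\overline{\overline n}_q\}+2p_{i-1}$, $$V_{i,j+1}=\sum_{t=0}^{j}\sum_{r=0}^{j-t}\sum_{k=0}^{j-t-r}\overline\Delta_{i,j-k-r-t+1}\bigl(d_{i,t+1}^*N_{i-1,r+1}-L_{i,t+1}^*Y_{i-1,r+1}\bigr)Z_{i-1,k+1}\quad(0\le j\le\overline b_i),$$ $$W_{i,j+1}=\sum_{r=0}^{j}\sum_{k=0}^{j-r}\overline{\overline\Delta}_{i,j-k-r+1}Y_{i-1,k+1}Y_{i-1,r+1}\quad(0\le j\le\overline{\overline b}_i).$$ In both cases put $q_i=\hat q_{i-1}+q+\max\{\overline n_q+n_q,\overline{\overline n}_q\}+\max\{\overline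 b_i,\overline{\overline b}_i\}$, $p_i=p_{i-1}+\overline{\overline n}_q+\overline{\overline b}_i$, $$\Theta_{i,j+1}=\sum_{r=0}^{j}\sum_{k=0}^{j-r}\bigl(Z_{i-1,j-k-r+1}\overline{\overline N}_{i-1,k+1}W_{i,r+1}-d_{i,j-k-r+1}\overline{\overline N}_{i-1,k+1}V_{i,r+1}\bigr)-\sum_{k=0}^{j}\varphi_{i,j-k+1}V_{i,k+1}\quad(0\le j\le q_i),$$ $$Z_{i,j+1}=\begin{bmatrix}\Theta_{i,j+1}\\ \sum_{k=0}^{j}\psi_{i,j-k+1}V_{i,k+1}\end{bmatrix}\ (0\le j\le q_i),\qquad Y_{i,j+1}=\sum_{k=0}^{j}\psi_{i,j-k+1}W_{i,k+1}\ (0\le j\le p_i).$$ **Theorem.** For every $1\le i\le n$ the polynomial $\sum_{j=0}^{p_i}Y_{i,j+1}s^j$ is nonzero, and $$X_i(s)=\frac{\sum_{j=0}^{q_i}Z_{i,j+1}s^j}{\sum_{j=0}^{p_i}Y_{i,j+1}s^j}$$ is the weighted Moore-Penrose inverse $\widehat A_i(s)^\dagger_{M,N_i}$ (which exists and is unique).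 In particular $X_n(s)=A(s)^\dagger_{M,N}$. -/

import Mathlib

open Polynomial
open scoped ComplexOrder

namespace WeightedMP

noncomputable section

/-! ### Conjugation on `ℂ(s)` -/

/-- Conjugation of the coefficients of a rational function, the indeterminate `s` being
self-conjugate (that is, `s` stands for a real variable). -/
def ratConj : RatFunc ℂ →+* RatFunc ℂ :=
  RatFunc.mapRingHom (Polynomial.mapRingHom (starRingEnd ℂ))
    (nonZeroDivisors_le_comap_nonZeroDivisors_of_injective _
      (Polynomial.map_injective _ (starRingEnd ℂ).injective))

theorem ratConj_algebraMap (p : ℂ[X]) :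
    ratConj (algebraMap ℂ[X] (RatFunc ℂ) p)
      = algebraMap ℂ[X] (RatFunc ℂ) (p.map (starRingEnd ℂ)) := by
  have h := RatFunc.map_apply_div (K := ℂ) (R := ℂ)
    (Polynomial.mapRingHom (starRingEnd ℂ))
    (nonZeroDivisors_le_comap_nonZeroDivisors_of_injective _
      (Polynomial.map_injective _ (starRingEnd ℂ).injective)) p 1
  simpa [ratConj, RatFunc.coe_mapRingHom_eq_coe_map] using h

theorem ratConj_ratConj (x : RatFunc ℂ) : ratConj (ratConj x) = x := by
  induction x using RatFunc.induction_on with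
  | f p q hq =>
    simp [map_div₀, ratConj_algebraMap, Polynomial.map_map]

/-- With this instance, `ᴴ` on matrices over `ℂ(s)` is the operation written `*`:
conjugate the coefficients and transpose. -/
instance ratFuncStarRing : StarRing (RatFunc ℂ) where
  star := ratConj
  star_involutive := ratConj_ratConj
  star_mul x y := by
    change ratConj (x * y) = ratConj y * ratConj x
    rw [map_mul, mul_comm]
  star_add x y := map_add ratConj x y

/-! ### Polynomial matrices and the weighted Moore-Penrose inverse -/

/-- A polynomial matrix regarded as a matrix over `ℂ(s)`. -/
def toRat {α β : Type*} (P : Matrix α β ℂ[X]) : Matrix α β (RatFunc ℂ) :=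
  P.map (algebraMap ℂ[X] (RatFunc ℂ))

/-- The constant matrix that is the coefficient of `s ^ j` in a polynomial matrix. -/
def coeffMat {α β : Type*} (P : Matrix α β ℂ[X]) (j : ℕ) : Matrix α β ℂ :=
  P.map fun p => p.coeff j

/-- A polynomial matrix is positive definite if its values at real points are positive definite,
in the weakest sense: at infinitely many real points.  This covers positive definiteness at every
real point, at all but finitely many of them, on an interval, or for all large `s`. -/
def IsPosDefPoly {k : ℕ} (P : Matrix (Fin k) (Fin k) ℂ[X]) : Prop :=
  {t : ℝ | (P.map (Polynomial.eval (t : ℂ))).PosDef}.Infinite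

/-- The four equations (1), (2), (3M), (4N) that define a weighted Moore-Penrose inverse. -/
structure IsWeightedMP {m n : ℕ} (M : Matrix (Fin m) (Fin m) (RatFunc ℂ))
    (N : Matrix (Fin n) (Fin n) (RatFunc ℂ)) (A : Matrix (Fin m) (Fin n) (RatFunc ℂ))
    (X : Matrix (Fin n) (Fin m) (RatFunc ℂ)) : Prop where
  eq_one : A * X * A = A
  eq_two : X * A * X = X
  eq_three : (M * A * X).conjTranspose = M * A * X
  eq_four : (N * X * A).conjTranspose = N * X * A

/-- `X` is the weighted Moore-Penrose inverse of `A`: it satisfies the four equations and is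
the only matrix that does. -/
def IsTheWeightedMP {m n : ℕ} (M : Matrix (Fin m) (Fin m) (RatFunc ℂ))
    (N : Matrix (Fin n) (Fin n) (RatFunc ℂ)) (A : Matrix (Fin m) (Fin n) (RatFunc ℂ))
    (X : Matrix (Fin n) (Fin m) (RatFunc ℂ)) : Prop :=
  IsWeightedMP M N A X ∧ ∀ X', IsWeightedMP M N A X' → X' = X

/-- The first `i` columns of `A`. -/
def leadCols {m n : ℕ} {R : Type*} (A : Matrix (Fin m) (Fin n) R) (i : ℕ) (hi : i ≤ n) :
    Matrix (Fin m) (Fin i) R :=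
  A.submatrix id (Fin.castLE hi)

/-- The leading principal submatrix of order `i` of `N`. -/
def leadPrincipal {n : ℕ} {R : Type*} (N : Matrix (Fin n) (Fin n) R) (i : ℕ) (hi : i ≤ n) :
    Matrix (Fin i) (Fin i) R :=
  N.submatrix (Fin.castLE hi) (Fin.castLE hi)

/-! ### The coefficient algorithm

All coefficient sequences are indexed by the power of `s`: entry `j` of a Lean sequence is
the coefficient of `s ^ j`, which carries the index `j + 1` in the usual `1`-based notation.
Coefficients outside the range in which they are computed count as zero. -/

/-- The input of the algorithm: the polynomial matrices `A`, `M`, `N` with their degree bounds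
`q`, `mq`, `nq`, and for each `k` a numerator `Nnum k` and a scalar denominator `Nden k`, with
degree bounds `nnum k` and `nden k`, meant to represent the inverse of the leading principal
submatrix of order `k` of `N`. -/
structure Input (m n : ℕ) where
  A : Matrix (Fin m) (Fin n) ℂ[X]
  M : Matrix (Fin m) (Fin m) ℂ[X]
  N : Matrix (Fin n) (Fin n) ℂ[X]
  q : ℕ
  mq : ℕ
  nq : ℕ
  Nnum : (k : ℕ) → Matrix (Fin k) (Fin k) ℂ[X]
  Nden : ℕ → ℂ[X]
  nnum : ℕ → ℕ
  nden : ℕ → ℕ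

/-- The result of stage `i`: coefficients `Z j` for `j ≤ q`, and `Y j` for `j ≤ p`. -/
structure Stage (m i : ℕ) where
  Z : ℕ → Matrix (Fin i) (Fin m) ℂ
  Y : ℕ → ℂ
  q : ℕ
  p : ℕ

/-- Keep the terms with index `≤ b`, and fill up with zeros. -/
def upTo {α : Type*} [Zero α] (b : ℕ) (f : ℕ → α) : ℕ → α :=
  fun j => if j ≤ b then f j else 0

/-- `∑_{k=0}^{j} f k` -/
def sum1 {α : Type*} [AddCommMonoid α] (j : ℕ) (f : ℕ → α) : α :=
  ∑ k ∈ Finset.range (j + 1), f k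

/-- `∑_{r=0}^{j} ∑_{k=0}^{j-r} f r k` -/
def sum2 {α : Type*} [AddCommMonoid α] (j : ℕ) (f : ℕ → ℕ → α) : α :=
  ∑ r ∈ Finset.range (j + 1), ∑ k ∈ Finset.range (j - r + 1), f r k

/-- `∑_{t=0}^{j} ∑_{r=0}^{j-t} ∑_{k=0}^{j-t-r} f t r k` -/
def sum3 {α : Type*} [AddCommMonoid α] (j : ℕ) (f : ℕ → ℕ → ℕ → α) : α :=
  ∑ t ∈ Finset.range (j + 1), ∑ r ∈ Finset.range (j - t + 1),
    ∑ k ∈ Finset.range (j - t - r + 1), f t r k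

open Matrix

variable {m n : ℕ} (D : Input m n)

namespace Input

/-- Coefficients of `M`. -/
def Mc (j : ℕ) : Matrix (Fin m) (Fin m) ℂ := coeffMat D.M j

/-- Coefficients of the column of `A` with (zero-based) number `k`. -/
def col (k : ℕ) (hk : k < n) (j : ℕ) : Fin m → ℂ := fun r => (D.A r ⟨k, hk⟩).coeff j

/-- Coefficients of the submatrix of the first `k` columns of `A`. -/
def Ahat (k : ℕ) (hk : k < n) (j : ℕ) : Matrix (Fin m) (Fin k) ℂ :=
  coeffMat (leadCols D.A k hk.le) j

/-- Coefficients of the leading principal submatrix of order `k` of `N`. -/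
def Nc (k : ℕ) (hk : k < n) (j : ℕ) : Matrix (Fin k) (Fin k) ℂ :=
  coeffMat (leadPrincipal D.N k hk.le) j

/-- Coefficients of the column `l` that borders the leading principal submatrix of order `k`. -/
def L (k : ℕ) (hk : k < n) (j : ℕ) : Fin k → ℂ :=
  fun r => (D.N (Fin.castLE hk.le r) ⟨k, hk⟩).coeff j

/-- Coefficients of the diagonal entry of `N` below that column. -/
def nHat (k : ℕ) (hk : k < n) (j : ℕ) : ℂ := (D.N ⟨k, hk⟩ ⟨k, hk⟩).coeff j

/-- Coefficients of the numerator of the inverse of the leading principal submatrix. -/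
def Nbar (k j : ℕ) : Matrix (Fin k) (Fin k) ℂ := coeffMat (D.Nnum k) j

/-- Coefficients of the denominator of the inverse of the leading principal submatrix. -/
def Nbarbar (k j : ℕ) : ℂ := (D.Nden k).coeff j

/-! #### Step 1 -/

open Classical in
/-- The initial stage, computed from the first column of `A`. -/
def first (h : 0 < n) : Stage m 1 where
  q := D.q + D.mq
  p := 2 * D.q + D.mq
  Z := if ∃ j ≤ D.q, D.col 0 h j ≠ 0 then
      upTo (D.q + D.mq) fun j =>
        Matrix.of fun _ => sum1 j fun k => star (D.col 0 h (j - k)) ᵥ* D.Mc k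
    else 0
  Y := if ∃ j ≤ D.q, D.col 0 h j ≠ 0 then
      upTo (2 * D.q + D.mq) fun j =>
        sum2 j fun r k => star (D.col 0 h (j - k - r)) ⬝ᵥ (D.Mc k *ᵥ D.col 0 h r)
    else fun j => if j = 0 then 1 else 0

/-! #### Step 2: from stage `k = i - 1` to stage `k + 1 = i`

`S` is the preceding stage; the column of `A` that is treated has zero-based number `k`. -/

variable (k : ℕ) (hk : k < n) (S : Stage m k)

def d : ℕ → Fin k → ℂ :=
  upTo (S.q + D.q) fun j => sum1 j fun κ => S.Z (j - κ) *ᵥ D.col k hk κ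

def qhat : ℕ := max S.p (S.q + D.q)

def c : ℕ → Fin m → ℂ :=
  upTo (D.qhat k S + D.q) fun j => sum1 j fun κ =>
    S.Y κ • D.col k hk (j - κ) - D.Ahat k hk (j - κ) *ᵥ D.d k hk S κ

/-- Coefficients of the constant polynomial matrix `I`. -/
def idCoeff (k j : ℕ) : Matrix (Fin k) (Fin k) ℂ := if j = 0 then 1 else 0

def phi : ℕ → Fin k → ℂ :=
  upTo (D.qhat k S + D.nnum k + D.nq) fun j => sum3 j fun t r κ =>
    (S.Y (j - κ - r - t) • idCoeff k κ - S.Z (j - κ - r - t) * D.Ahat k hk κ)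
      *ᵥ (D.Nbar k r *ᵥ D.L k hk t)

def psi : ℕ → ℂ :=
  upTo (S.p + D.nden k) fun j => sum1 j fun κ => S.Y (j - κ) * D.Nbarbar k κ

/-- Numerator of `1 / δ`. -/
def Delta1 : ℕ → ℂ :=
  upTo (2 * S.p + D.nden k) fun j => sum2 j fun r κ =>
    S.Y (j - κ - r) * S.Y κ * D.Nbarbar k r

/-- Denominator of `1 / δ`. -/
def Delta2 : ℕ → ℂ :=
  upTo (2 * D.qhat k S + D.nq + max (D.nq + D.nnum k) (D.nden k)) fun j =>
    (sum3 j fun t r κ =>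
      (D.nHat k hk (j - κ - r - t) * S.Y κ * S.Y r
        + star (D.d k hk S (j - κ - r - t)) ⬝ᵥ (D.Nc k hk κ *ᵥ D.d k hk S r)
        - (star (D.d k hk S (j - κ - r - t)) ⬝ᵥ D.L k hk κ) * S.Y r
        - (star (D.L k hk (j - κ - r - t)) ⬝ᵥ D.d k hk S κ) * S.Y r) * D.Nbarbar k t)
    - sum2 j fun r κ => (star (D.L k hk (j - κ - r)) ⬝ᵥ D.phi k hk S κ) * S.Y r

/-- The case distinction of Step 2.3. -/
def cNonzero : Prop := ∃ j ≤ D.qhat k S + D.q, D.c k hk S j ≠ 0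

open Classical in
/-- Degree bound for `V`. -/
def bV : ℕ :=
  if D.cNonzero k hk S then D.qhat k S + D.q + S.p + D.mq
  else 2 * S.p + D.nden k + S.q + D.qhat k S + D.nq

open Classical in
/-- Degree bound for `W`. -/
def bW : ℕ :=
  if D.cNonzero k hk S then 2 * D.qhat k S + 2 * D.q + D.mq
  else 2 * D.qhat k S + D.nq + max (D.nq + D.nnum k) (D.nden k) + 2 * S.p

open Classical in
/-- Coefficients (row vectors) of the numerator of the last row of `X_i`. -/
def V : ℕ → Fin m → ℂ :=
  upTo (D.bV k hk S) fun j =>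
    if D.cNonzero k hk S then
      sum2 j fun r κ => S.Y (j - κ - r) • (star (D.c k hk S κ) ᵥ* D.Mc r)
    else
      sum3 j fun t r κ =>
        D.Delta1 k S (j - κ - r - t) •
            ((star (D.d k hk S t) ᵥ* D.Nc k hk r) ᵥ* S.Z κ)
          - (D.Delta1 k S (j - κ - r - t) * S.Y r) • (star (D.L k hk t) ᵥ* S.Z κ)

open Classical in
/-- Coefficients of the denominator of the last row of `X_i`. -/
def W : ℕ → ℂ :=
  upTo (D.bW k hk S) fun j =>
    if D.cNonzero k hk S then
      sum2 j fun r κ => star (D.c k hk S (j - κ - r)) ⬝ᵥ (D.Mc κ *ᵥ D.c k hk S r)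
    else
      sum2 j fun r κ => D.Delta2 k hk S (j - κ - r) * S.Y κ * S.Y r

def qNext : ℕ :=
  D.qhat k S + D.q + max (D.nnum k + D.nq) (D.nden k) + max (D.bV k hk S) (D.bW k hk S)

def pNext : ℕ := S.p + D.nden k + D.bW k hk S

def Theta : ℕ → Matrix (Fin k) (Fin m) ℂ :=
  upTo (D.qNext k hk S) fun j =>
    (sum2 j fun r κ =>
      (D.Nbarbar k κ * D.W k hk S r) • S.Z (j - κ - r)
        - D.Nbarbar k κ • vecMulVec (D.d k hk S (j - κ - r)) (D.V k hk S r))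
    - sum1 j fun κ => vecMulVec (D.phi k hk S (j - κ)) (D.V k hk S κ)

/-- Append a last row to a matrix. -/
def appendRow {k m : ℕ} (P : Matrix (Fin k) (Fin m) ℂ) (v : Fin m → ℂ) :
    Matrix (Fin (k + 1)) (Fin m) ℂ :=
  Matrix.of (Fin.snoc (α := fun _ => Fin m → ℂ) (fun r => P r) v)

def next : Stage m (k + 1) where
  q := D.qNext k hk S
  p := D.pNext k hk S
  Z := upTo (D.qNext k hk S) fun j =>
    appendRow (D.Theta k hk S j) (sum1 j fun κ => D.psi k S (j - κ) • D.V k hk S κ)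
  Y := upTo (D.pNext k hk S) fun j => sum1 j fun κ => D.psi k S (j - κ) * D.W k hk S κ

/-- The stages of the algorithm.  Stage `0` is a placeholder; the algorithm starts with
stage `1` and stops with stage `n`. -/
def stage : (i : ℕ) → i ≤ n → Stage m i
  | 0, _ => { Z := 0, Y := fun j => if j = 0 then 1 else 0, q := 0, p := 0 }
  | 1, h => D.first h
  | k + 2, h => D.next (k + 1) h (stage (k + 1) (Nat.le_of_succ_le h))

end Input

/-! #### The rational matrix represented by a stage -/

/-- The numerator `∑_{j ≤ q} Z_j s^j`. -/
def Stage.num {m i : ℕ} (S : Stage m i) : Matrix (Fin i) (Fin m) ℂ[X] :=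
  ∑ j ∈ Finset.range (S.q + 1), (X ^ j : ℂ[X]) • (S.Z j).map (C : ℂ → ℂ[X])

/-- The denominator `∑_{j ≤ p} Y_j s^j`. -/
def Stage.den {m i : ℕ} (S : Stage m i) : ℂ[X] :=
  ∑ j ∈ Finset.range (S.p + 1), C (S.Y j) * X ^ j

/-- The quotient of the numerator by the denominator, a matrix over `ℂ(s)`. -/
def Stage.quotient {m i : ℕ} (S : Stage m i) : Matrix (Fin i) (Fin m) (RatFunc ℂ) :=
  (algebraMap ℂ[X] (RatFunc ℂ) S.den)⁻¹ • toRat S.num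

end

end WeightedMP

/-!
The algorithm is Greville's column recursion for the weighted Moore-Penrose inverse (in the form of
Wang and Chen), carried out on the coefficients of numerators and denominators.

Let `X = B†` for the weights `M` and `N`, append a column `a` to `B`, and border `N` by `l` and `ν`.
With `d = X a`, `c = a - B d` and `e = (I - X B) N⁻¹ l`, the new inverse has the rows of
`X - (d + e) b` followed by the row `b`, where
* `b = (cᴴ M c)⁻¹ cᴴ M` if `c ≠ 0`;
* `b = δ⁻¹ (dᴴ N - lᴴ) X` with `δ = ν + dᴴ N d - dᴴ l - lᴴ d - lᴴ e` if `c = 0`.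
The four equations are verified block by block (`PenroseEqs.bordered_of_independent`,
`PenroseEqs.bordered_of_dependent`).  Both divisions are legitimate because the forms are definite
over `ℂ(s)`: `cᴴ M c` is a value of the form `M`, and `δ` is the value of the bordered form at the
nonzero vector `(d + e, -1)` (`PenroseEqs.bordered_form_eq`).  Definiteness over `ℂ(s)` follows from
positive definiteness at infinitely many real points, by evaluating a polynomial vector there
(`IsPosDefPoly.isDefiniteHermitian`); it also makes the weights invertible, which gives uniqueness
(`PenroseEqs.unique`).

Writing `X = Z / y` and `N⁻¹ = Nb / β` and clearing denominators, one obtains formulas that make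
sense over `ℂ[s]`; they are collected in `StepData`, and `StepData.penroseEqs_next` says that they
compute the new inverse.  The formulas write `y` and `β` where conjugates would be expected, so the
induction also carries the fact that the denominators are self-conjugate.  Finally, the sums of
the algorithm are Cauchy products, and no range of indices is shorter than the degree of the
polynomial computed, so that a step of the algorithm produces exactly the coefficients of the
polynomial step (`Input.represents_next`).
-/

namespace WeightedMP
open Matrix

/-! ### Bordering a matrix with a known weighted Moore-Penrose inverse -/

section Bordering

theorem star_eq_of_mul_eq_one {R : Type*} [CommRing R] [StarRing R] {w wi : R} (hw : star w = w)
    (hwi : wi * w = 1) : star wi = wi := by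
  have h1 : star wi * w = 1 := by
    rw [← hw, ← star_mul', hwi, star_one]
  calc star wi = star wi * (wi * w) := by rw [hwi, mul_one]
    _ = wi * (star wi * w) := by ring
    _ = wi := by rw [h1, mul_one]

/-- The four equations of a weighted Moore-Penrose inverse, over any commutative star ring and with
arbitrary finite index types, so that they apply to block matrices indexed by a sum type. -/
structure PenroseEqs {R μ κ : Type*} [CommRing R] [StarRing R] [Fintype μ] [Fintype κ]
    (M : Matrix μ μ R) (N : Matrix κ κ R) (A : Matrix μ κ R) (X : Matrix κ μ R) : Prop where
  eq_one : A * X * A = A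
  eq_two : X * A * X = X
  eq_three : (M * A * X)ᴴ = M * A * X
  eq_four : (N * X * A)ᴴ = N * X * A

variable {R μ κ o : Type*} [CommRing R] [StarRing R] [Fintype μ] [Fintype κ]

variable {M : Matrix μ μ R} {N Ni : Matrix κ κ R} {B : Matrix μ κ R} {X : Matrix κ μ R}
  {a : Matrix μ o R} {l : Matrix κ o R} {ν : Matrix o o R} {b : Matrix o μ R}

namespace PenroseEqs

/-- Equation (4) read as: `X B` is self-adjoint for the form `N`. -/
theorem conj_mul (h : PenroseEqs M N B X) (hN : Nᴴ = N) : (X * B)ᴴ * N = N * X * B := by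
  have := h.eq_four
  rwa [Matrix.mul_assoc, conjTranspose_mul, hN, ← Matrix.mul_assoc] at this

/-- Equation (3) read as: `B X` is self-adjoint for the form `M`. -/
theorem conj_mul_left (h : PenroseEqs M N B X) (hM : Mᴴ = M) : (B * X)ᴴ * M = M * B * X := by
  have := h.eq_three
  rwa [Matrix.mul_assoc, conjTranspose_mul, hM, ← Matrix.mul_assoc] at this

/-- With `d = X a`, the row `dᴴ N` is unchanged by `X B`. -/
theorem conj_mul_weight_mul (h : PenroseEqs M N B X) (hN : Nᴴ = N) :
    (X * a)ᴴ * N * (X * B) = (X * a)ᴴ * N := by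
  have hXBd : X * (B * (X * a)) = X * a := by
    rw [← Matrix.mul_assoc, ← Matrix.mul_assoc, h.eq_two]
  have : N * (X * a) = (X * B)ᴴ * (N * (X * a)) := by
    rw [← Matrix.mul_assoc _ N, h.conj_mul hN]
    simp only [Matrix.mul_assoc]
    rw [hXBd]
  have h2 := congrArg conjTranspose this
  rw [conjTranspose_mul, conjTranspose_mul _ (N * (X * a)), conjTranspose_mul N, hN,
    conjTranspose_conjTranspose] at h2
  exact h2.symm

variable [DecidableEq κ]

theorem mul_inv_eq_conj (h : PenroseEqs M N B X) (hN : Nᴴ = N) (hNi : N * Ni = 1) :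
    N * X * B * Ni = (X * B)ᴴ := by
  rw [← h.conj_mul hN, mul_assoc, hNi, mul_one]

/-- `N (I - X B) N⁻¹ l = l - (X B)ᴴ l`. -/
theorem mul_correction (h : PenroseEqs M N B X) (hN : Nᴴ = N) (hNi : N * Ni = 1) :
    N * ((1 - X * B) * Ni * l) = l - (X * B)ᴴ * l := by
  rw [← h.mul_inv_eq_conj hN hNi]
  simp only [Matrix.sub_mul, Matrix.mul_sub, Matrix.one_mul, ← Matrix.mul_assoc, hNi]

theorem left_annihilates (h : PenroseEqs M N B X) : B * ((1 - X * B) * Ni * l) = 0 := by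
  have : B * (1 - X * B) = 0 := by
    rw [Matrix.mul_sub, ← Matrix.mul_assoc, h.eq_one, Matrix.mul_one, sub_self]
  simp only [← Matrix.mul_assoc, this, Matrix.zero_mul]

theorem correction_hermitian (h : PenroseEqs M N B X) (hN : Nᴴ = N) (hNi : N * Ni = 1) :
    (lᴴ * ((1 - X * B) * Ni * l))ᴴ = lᴴ * ((1 - X * B) * Ni * l) := by
  have hNi' : Ni * N = 1 := mul_eq_one_comm.mp hNi
  have hNiH : Niᴴ = Ni := by
    have h1 : Niᴴ * N = 1 := by
      rw [← hN, ← conjTranspose_mul, hNi, conjTranspose_one]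
    calc Niᴴ = Niᴴ * (N * Ni) := by rw [hNi, mul_one]
      _ = Ni := by rw [← mul_assoc, h1, one_mul]
  have h2 : X * B * Ni = Ni * (X * B)ᴴ := by
    rw [← h.mul_inv_eq_conj hN hNi]
    simp only [← mul_assoc, hNi', ← Matrix.mul_assoc, Matrix.one_mul]
  have h3 : ((1 - X * B) * Ni)ᴴ = (1 - X * B) * Ni := by
    rw [conjTranspose_mul, hNiH, conjTranspose_sub, conjTranspose_one, mul_sub, ← h2, sub_mul,
      one_mul, mul_one]
  rw [conjTranspose_mul, conjTranspose_mul, h3, conjTranspose_conjTranspose, Matrix.mul_assoc]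

/-- With `d = X a` and `e = (I - X B) N⁻¹ l`, the vector `N (d + e) - l` is the adjoint of the row
`g = (dᴴ N - lᴴ) X B`.  In the dependent case `g = δ b B`, where `b` is the last row of the new
inverse, and this symmetry is what makes the bordered equation (4) hold. -/
theorem weight_mul_sub (h : PenroseEqs M N B X) (hN : Nᴴ = N) (hNi : N * Ni = 1) :
    N * (X * a + (1 - X * B) * Ni * l) - l = (((X * a)ᴴ * N - lᴴ) * (X * B))ᴴ := by
  rw [Matrix.sub_mul ((X * a)ᴴ * N), h.conj_mul_weight_mul hN, Matrix.mul_add,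
    h.mul_correction hN hNi, conjTranspose_sub, conjTranspose_mul _ N, conjTranspose_mul lᴴ, hN,
    conjTranspose_conjTranspose, conjTranspose_conjTranspose]
  abel

variable [Fintype o] [DecidableEq o]

/-- The bordered inverse when the new columns `a` contribute `c = a - B X a` with `cᴴ M c = w` an
invertible scalar.  The last rows are `b = w⁻¹ cᴴ M`; since `cᴴ M B = 0`, they satisfy `b B = 0` and
`b a = 1`. -/
theorem bordered_of_independent (h : PenroseEqs M N B X) (hN : Nᴴ = N) (hNi : N * Ni = 1)
    (hM : Mᴴ = M) (hν : νᴴ = ν) {w wi : R} (hw : star w = w) (hwi : wi * w = 1)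
    (hweq : w • (1 : Matrix o o R) = (a - B * (X * a))ᴴ * M * (a - B * (X * a)))
    (hb : b = wi • ((a - B * (X * a))ᴴ * M)) :
    PenroseEqs M (fromBlocks N l lᴴ ν) (fromCols B a)
      (fromRows (X - (X * a + (1 - X * B) * Ni * l) * b) b) := by
  set e := (1 - X * B) * Ni * l with he
  have hBe : B * e = 0 := h.left_annihilates
  have hB : B * (X * B) = B := by rw [← Matrix.mul_assoc, h.eq_one]
  have hcB : (a - B * (X * a))ᴴ * M * B = 0 := by
    rw [← Matrix.mul_assoc B, conjTranspose_sub, conjTranspose_mul, Matrix.sub_mul,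
      Matrix.mul_assoc aᴴ, h.conj_mul_left hM, Matrix.sub_mul]
    simp only [Matrix.mul_assoc]
    rw [hB, sub_self]
  have hbB : b * B = 0 := by rw [hb, Matrix.smul_mul, hcB, smul_zero]
  have hba : b * a = 1 := by
    have h1 : (a - B * (X * a))ᴴ * M * a = w • 1 := by
      rw [hweq, Matrix.mul_sub, ← Matrix.mul_assoc _ B, hcB, Matrix.zero_mul, sub_zero]
    rw [hb, Matrix.smul_mul, h1, smul_smul, hwi, one_smul]
  have hwi' : star wi = wi := star_eq_of_mul_eq_one hw hwi
  have hMcb : (M * (a - B * (X * a)) * b)ᴴ = M * (a - B * (X * a)) * b := by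
    rw [hb]
    simp only [Matrix.mul_smul, conjTranspose_smul, conjTranspose_mul, hwi', hM,
      conjTranspose_conjTranspose, Matrix.mul_assoc]
  have hBX : fromCols B a * fromRows (X - (X * a + e) * b) b
      = B * X + (a - B * (X * a)) * b := by
    rw [fromCols_mul_fromRows]
    simp only [Matrix.mul_sub, Matrix.add_mul, Matrix.sub_mul, Matrix.mul_add, ← Matrix.mul_assoc,
      hBe, Matrix.zero_mul]
    abel
  have hXB : fromRows (X - (X * a + e) * b) b * fromCols B a
      = fromBlocks (X * B) (-e) 0 1 := by
    rw [fromRows_mul_fromCols]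
    simp only [Matrix.sub_mul, Matrix.mul_assoc, hbB, hba, Matrix.mul_zero, Matrix.mul_one,
      sub_zero]
    congr 1
    abel
  refine ⟨?_, ?_, ?_, ?_⟩
  · rw [hBX, mul_fromCols]
    congr 1
    · rw [Matrix.add_mul, h.eq_one, Matrix.mul_assoc, hbB, Matrix.mul_zero, add_zero]
    · rw [Matrix.add_mul, Matrix.mul_assoc _ b, hba, Matrix.mul_one, Matrix.mul_assoc]
      abel
  · rw [hXB, fromBlocks_mul_fromRows]
    congr 1
    · have h1 : X * B * X = X := h.eq_two
      have h2 : X * B * e = 0 := by rw [Matrix.mul_assoc, hBe, Matrix.mul_zero]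
      simp only [Matrix.mul_sub, Matrix.add_mul, Matrix.mul_add, ← Matrix.mul_assoc, h1, h2,
        Matrix.zero_mul, Matrix.neg_mul]
      abel
    · simp
  · rw [Matrix.mul_assoc M, hBX, Matrix.mul_add, conjTranspose_add, ← Matrix.mul_assoc,
      ← Matrix.mul_assoc, h.eq_three, hMcb]
  · rw [Matrix.mul_assoc (fromBlocks N l lᴴ ν), hXB, fromBlocks_multiply]
    have hNe : N * e = l - (X * B)ᴴ * l := h.mul_correction hN hNi
    have hle : (lᴴ * e)ᴴ = lᴴ * e := h.correction_hermitian hN hNi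
    rw [fromBlocks_conjTranspose]
    simp only [Matrix.mul_neg, hNe, Matrix.mul_zero, Matrix.mul_one, add_zero,
      conjTranspose_add, conjTranspose_neg, hle, hν, conjTranspose_sub,
      conjTranspose_mul, conjTranspose_conjTranspose]
    congr 1
    · rw [← conjTranspose_mul, ← conjTranspose_mul, ← Matrix.mul_assoc, h.eq_four]
    · rw [← conjTranspose_mul]; abel
    · abel

/-- The bordered inverse when the new columns `a = B X a` lie in the column space of `B`.  The last
rows are `b = δ⁻¹ (dᴴ N - lᴴ) X`, where `d = X a`. -/
theorem bordered_of_dependent (h : PenroseEqs M N B X) (hN : Nᴴ = N) (hNi : N * Ni = 1)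
    (ha : a = B * (X * a)) {δ δi : R} (hδ : star δ = δ) (hδi : δi * δ = 1)
    (hδeq : δ • (1 : Matrix o o R) = ν + (X * a)ᴴ * N * (X * a) - (X * a)ᴴ * l - lᴴ * (X * a)
      - lᴴ * ((1 - X * B) * Ni * l))
    (hb : b = δi • (((X * a)ᴴ * N - lᴴ) * X)) :
    PenroseEqs M (fromBlocks N l lᴴ ν) (fromCols B a)
      (fromRows (X - (X * a + (1 - X * B) * Ni * l) * b) b) := by
  set e := (1 - X * B) * Ni * l with he
  set d := X * a with hd
  have hBe : B * e = 0 := h.left_annihilates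
  have hbBX : b * (B * X) = b := by
    rw [hb, Matrix.smul_mul, Matrix.mul_assoc, ← Matrix.mul_assoc X B X, h.eq_two]
  have hXBd : X * (B * d) = d := by rw [← ha]
  have hδi' : star δi = δi := star_eq_of_mul_eq_one hδ hδi
  set g := (dᴴ * N - lᴴ) * (X * B) with hg
  have hbB : b * B = δi • g := by rw [hb, hg, Matrix.smul_mul, Matrix.mul_assoc]
  have hgd : g * d = dᴴ * N * d - lᴴ * d := by
    rw [hg, Matrix.mul_assoc, Matrix.mul_assoc X, hXBd, Matrix.sub_mul]
  have hba : b * a = δi • (g * d) := by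
    rw [ha, ← Matrix.mul_assoc, hbB, Matrix.smul_mul]
  have hdN : dᴴ * N * (X * B) = dᴴ * N := h.conj_mul_weight_mul hN
  have hg' : g = dᴴ * N - lᴴ * (X * B) := by rw [hg, Matrix.sub_mul, hdN]
  have hNf : N * (d + e) - l = gᴴ := h.weight_mul_sub hN hNi
  have hνf : ν - lᴴ * (d + e) = δ • 1 - (g * d)ᴴ := by
    rw [hδeq, hgd, Matrix.mul_add]
    simp only [conjTranspose_sub, conjTranspose_mul, conjTranspose_conjTranspose, hN,
      Matrix.mul_assoc]
    abel
  have hBX : fromCols B a * fromRows (X - (d + e) * b) b = B * X := by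
    rw [fromCols_mul_fromRows]
    have : B * (d + e) = a := by rw [Matrix.mul_add, hBe, add_zero, ← ha]
    rw [Matrix.mul_sub, ← Matrix.mul_assoc, this]
    abel
  -- The blocks of `N' X' B'` are expressed through `g`; in that form their symmetry is visible.
  refine ⟨?_, ?_, ?_, ?_⟩
  · rw [hBX, mul_fromCols, h.eq_one, Matrix.mul_assoc, ← hd, ← ha]
  · rw [Matrix.mul_assoc, hBX, fromRows_mul, hbBX, Matrix.sub_mul, Matrix.mul_assoc _ b, hbBX,
      ← Matrix.mul_assoc, h.eq_two]
  · rw [Matrix.mul_assoc, hBX, ← Matrix.mul_assoc, h.eq_three]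
  · have h11 : N * ((X - (d + e) * b) * B) + l * (b * B) = N * X * B - δi • (gᴴ * g) := by
      have : l = N * (d + e) - gᴴ := by rw [← hNf]; abel
      rw [Matrix.sub_mul, Matrix.mul_assoc _ b, hbB, Matrix.mul_sub]
      conv_lhs => rw [this]
      simp only [Matrix.mul_smul, Matrix.sub_mul, Matrix.mul_assoc, smul_sub]
      abel
    have h12 : N * ((X - (d + e) * b) * a) + l * (b * a) = N * d - δi • (gᴴ * (g * d)) := by
      have : l = N * (d + e) - gᴴ := by rw [← hNf]; abel
      rw [Matrix.sub_mul, Matrix.mul_assoc _ b, hba, Matrix.mul_sub, ← hd]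
      conv_lhs => rw [this]
      simp only [Matrix.mul_smul, Matrix.sub_mul, Matrix.mul_assoc, smul_sub]
      abel
    have h21 : lᴴ * ((X - (d + e) * b) * B) + ν * (b * B)
        = dᴴ * N - δi • ((g * d)ᴴ * g) := by
      have : lᴴ * ((X - (d + e) * b) * B) + ν * (b * B)
          = lᴴ * (X * B) + (ν - lᴴ * (d + e)) * (b * B) := by
        simp only [Matrix.sub_mul, Matrix.mul_sub, Matrix.mul_assoc]
        abel
      rw [this, hνf, hbB, Matrix.sub_mul, Matrix.mul_smul, Matrix.smul_mul, Matrix.one_mul,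
        smul_smul, hδi, one_smul, Matrix.mul_smul]
      have h3 : lᴴ * (X * B) + g = dᴴ * N := by rw [hg']; abel
      rw [← h3]
      abel
    have h22 : lᴴ * ((X - (d + e) * b) * a) + ν * (b * a)
        = dᴴ * N * d - δi • ((g * d)ᴴ * (g * d)) := by
      have : lᴴ * ((X - (d + e) * b) * a) + ν * (b * a)
          = lᴴ * d + (ν - lᴴ * (d + e)) * (b * a) := by
        simp only [Matrix.sub_mul, Matrix.mul_sub, Matrix.mul_assoc, hd]
        abel
      rw [this, hνf, hba, Matrix.sub_mul, Matrix.mul_smul, Matrix.smul_mul, Matrix.one_mul,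
        smul_smul, hδi, one_smul, Matrix.mul_smul]
      have h3 : lᴴ * d + g * d = dᴴ * N * d := by rw [hgd]; abel
      rw [← h3]
      abel
    rw [Matrix.mul_assoc (fromBlocks N l lᴴ ν), fromRows_mul_fromCols, fromBlocks_multiply,
      h11, h12, h21, h22, fromBlocks_conjTranspose]
    simp only [conjTranspose_sub, conjTranspose_smul, hδi', h.eq_four]
    congr 1 <;>
      simp only [conjTranspose_mul, conjTranspose_conjTranspose, hN, Matrix.mul_assoc]

/-- `δ` is the value of the bordered form at `(d + e, -1)`.  This is why `δ` is self-conjugate, and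
nonzero when the bordered form is definite. -/
theorem bordered_form_eq (h : PenroseEqs M N B X) (hN : Nᴴ = N) (hNi : N * Ni = 1) :
    (fromRows (X * a + (1 - X * B) * Ni * l) (-1 : Matrix o o R))ᴴ
        * (fromBlocks N l lᴴ ν
          * fromRows (X * a + (1 - X * B) * Ni * l) (-1 : Matrix o o R)) =
      ν + (X * a)ᴴ * N * (X * a) - (X * a)ᴴ * l - lᴴ * (X * a)
      - lᴴ * ((1 - X * B) * Ni * l) := by
  have hBe : B * ((1 - X * B) * Ni * l) = 0 := h.left_annihilates
  have hNf := h.weight_mul_sub (a := a) (l := l) hN hNi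
  have hXBd : X * (B * (X * a)) = X * a := by
    rw [← Matrix.mul_assoc, ← Matrix.mul_assoc, h.eq_two]
  set e := (1 - X * B) * Ni * l with he
  set d := X * a with hd
  have hgf : (dᴴ * N - lᴴ) * (X * B) * (d + e) = dᴴ * N * d - lᴴ * d := by
    rw [Matrix.mul_add, Matrix.mul_assoc _ (X * B), Matrix.mul_assoc X, hXBd,
      Matrix.mul_assoc _ (X * B), Matrix.mul_assoc X, hBe, Matrix.mul_zero, Matrix.mul_zero,
      add_zero, Matrix.sub_mul]
  have h1 : N * (d + e) + l * (-1 : Matrix o o R) = ((dᴴ * N - lᴴ) * (X * B))ᴴ := by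
    rw [← hNf, Matrix.mul_neg, Matrix.mul_one, sub_eq_add_neg]
  rw [fromBlocks_mul_fromRows, conjTranspose_fromRows_eq_fromCols_conjTranspose,
    fromCols_mul_fromRows, h1, ← conjTranspose_mul, hgf]
  simp only [conjTranspose_sub, conjTranspose_mul, conjTranspose_neg, conjTranspose_one,
    conjTranspose_conjTranspose, hN, Matrix.mul_assoc, Matrix.mul_neg, Matrix.neg_mul,
    Matrix.mul_add, Matrix.one_mul, Matrix.mul_one]
  abel

/-- Uniqueness for Hermitian weights with left inverses: `B X` and `X B` are determined, being the
self-adjoint projections for the two weights, and `X = (X B) X = X (B X)`. -/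
theorem unique [DecidableEq μ] {Mi : Matrix μ μ R} {X' : Matrix κ μ R} (h : PenroseEqs M N B X)
    (h' : PenroseEqs M N B X') (hM : Mᴴ = M) (hMi : Mi * M = 1) (hN : Nᴴ = N)
    (hNi : Ni * N = 1) : X' = X := by
  have hl : B * X' = B * X := by
    have e1 : M * (B * X) = M * (B * X') := by
      calc M * (B * X) = M * ((B * X') * (B * X)) := by
            rw [← Matrix.mul_assoc (B * X'), h'.eq_one]
        _ = (B * X')ᴴ * ((B * X)ᴴ * M) := by
            rw [h.conj_mul_left hM, ← Matrix.mul_assoc, ← Matrix.mul_assoc M B X',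
              ← h'.conj_mul_left hM]
            simp only [Matrix.mul_assoc]
        _ = (B * X * (B * X'))ᴴ * M := by
            simp only [conjTranspose_mul, Matrix.mul_assoc]
        _ = M * (B * X') := by
            rw [← Matrix.mul_assoc (B * X), h.eq_one, h'.conj_mul_left hM, Matrix.mul_assoc]
    have := congrArg (Mi * ·) e1
    simpa only [← Matrix.mul_assoc, hMi, Matrix.one_mul] using this.symm
  have hr : X' * B = X * B := by
    have e1 : N * (X * B) = N * (X' * B) := by
      calc N * (X * B) = N * ((X * B) * (X' * B)) := by
            rw [Matrix.mul_assoc X B, ← Matrix.mul_assoc B, h'.eq_one]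
        _ = (X * B)ᴴ * ((X' * B)ᴴ * N) := by
            rw [h'.conj_mul hN, ← Matrix.mul_assoc, ← Matrix.mul_assoc N X B, ← h.conj_mul hN]
            simp only [Matrix.mul_assoc]
        _ = (X' * B * (X * B))ᴴ * N := by
            simp only [conjTranspose_mul, Matrix.mul_assoc]
        _ = N * (X' * B) := by
            rw [Matrix.mul_assoc X' B, ← Matrix.mul_assoc B, h.eq_one, h'.conj_mul hN,
              Matrix.mul_assoc]
    have := congrArg (Ni * ·) e1
    simpa only [← Matrix.mul_assoc, hNi, Matrix.one_mul] using this.symm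
  calc X' = X' * B * X' := h'.eq_two.symm
    _ = X * B * X' := by rw [hr]
    _ = X * B * X := by rw [Matrix.mul_assoc, hl, ← Matrix.mul_assoc]
    _ = X := h.eq_two

end PenroseEqs
end Bordering

/-! ### Definite weights and bordering by one column -/

section OneColumn

variable {K : Type*} [Field K] [StarRing K]

/-- A Hermitian matrix whose form has no nonzero isotropic vector.  Over `ℂ(s)`, where no order is
used, this stands in for positive definiteness. -/
structure IsDefiniteHermitian {ι : Type*} [Fintype ι] (M : Matrix ι ι K) : Prop where
  isHermitian : Mᴴ = M
  eq_zero_of_form_eq_zero : ∀ v : ι → K, star v ⬝ᵥ (M *ᵥ v) = 0 → v = 0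

theorem IsDefiniteHermitian.isUnit_det {ι : Type*} [Fintype ι] [DecidableEq ι]
    {M : Matrix ι ι K} (hM : IsDefiniteHermitian M) : IsUnit M.det := by
  rw [isUnit_iff_ne_zero]
  intro h
  obtain ⟨v, hv, hMv⟩ := Matrix.exists_mulVec_eq_zero_iff.mpr h
  exact hv (hM.eq_zero_of_form_eq_zero v (by rw [hMv, dotProduct_zero]))

theorem star_form_of_conjTranspose_eq {ι : Type*} [Fintype ι]
    {M : Matrix ι ι K} (hM : Mᴴ = M) (v w : ι → K) :
    star (star v ⬝ᵥ (M *ᵥ w)) = star w ⬝ᵥ (M *ᵥ v) := by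
  rw [← star_dotProduct, star_mulVec, hM, ← dotProduct_mulVec]

variable {μ : Type*} [Fintype μ] {k : ℕ}

/-- The four equations may be checked after a reindexing of the columns of `B`. -/
theorem PenroseEqs.of_submatrix {κ κ' : Type*} [Fintype κ] [Fintype κ'] (e : κ' ≃ κ)
    {M : Matrix μ μ K} {N : Matrix κ κ K} {B : Matrix μ κ K} {X : Matrix κ μ K}
    (h : PenroseEqs M (N.submatrix e e) (B.submatrix id e) (X.submatrix e id)) :
    PenroseEqs M N B X := by
  have hBX : B.submatrix id e * X.submatrix e id = B * X := submatrix_mul_equiv B X id e id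
  have hXB : X.submatrix e id * B.submatrix id e = (X * B).submatrix e e := by
    ext i j; rfl
  constructor
  · have := h.eq_one
    rw [hBX] at this
    ext i j
    simpa [Matrix.mul_apply] using congrFun (congrFun this i) (e.symm j)
  · have := h.eq_two
    rw [Matrix.mul_assoc, hBX] at this
    ext i j
    rw [Matrix.mul_assoc]
    simpa [Matrix.mul_apply] using congrFun (congrFun this (e.symm i)) j
  · have := h.eq_three
    rwa [Matrix.mul_assoc, hBX, ← Matrix.mul_assoc] at this
  · have := h.eq_four
    rw [Matrix.mul_assoc, hXB, submatrix_mul_equiv, conjTranspose_submatrix] at this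
    rw [Matrix.mul_assoc]
    have h2 := congrArg (fun P => P.submatrix e.symm e.symm) this
    simpa only [submatrix_submatrix, e.self_comp_symm, submatrix_id_id] using h2

/-- The rows of `X - f b`, followed by the row `b`. -/
def correctedRows (X : Matrix (Fin k) μ K) (f : Fin k → K) (b : μ → K) :
    Matrix (Fin (k + 1)) μ K :=
  of (Fin.snoc (α := fun _ => μ → K) (fun r => (X - vecMulVec f b) r) b)

/-- Under `Fin k ⊕ Fin 1 ≃ Fin (k + 1)` the right summand is the last index. -/
theorem finSumFinEquiv_inr_one (i : Fin 1) : finSumFinEquiv (Sum.inr i) = Fin.last k := by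
  ext; simp

theorem submatrix_finSumFinEquiv_eq_fromBlocks {N : Matrix (Fin (k + 1)) (Fin (k + 1)) K}
    (hN : Nᴴ = N) :
    N.submatrix (finSumFinEquiv (m := k) (n := 1)) (finSumFinEquiv (m := k) (n := 1)) =
      fromBlocks (N.submatrix Fin.castSucc Fin.castSucc)
        (replicateCol (Fin 1) fun r => N (Fin.castSucc r) (Fin.last k))
        (replicateCol (Fin 1) fun r => N (Fin.castSucc r) (Fin.last k))ᴴ
        (of fun _ _ => N (Fin.last k) (Fin.last k)) := by
  ext (i | i) (j | j)
  · rfl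
  · rw [submatrix_apply, finSumFinEquiv_inr_one]; rfl
  · rw [submatrix_apply, finSumFinEquiv_inr_one]
    exact (congrFun (congrFun hN (Fin.last k)) (Fin.castSucc j)).symm
  · rw [submatrix_apply, finSumFinEquiv_inr_one, finSumFinEquiv_inr_one]; rfl

theorem PenroseEqs.of_blocks {M : Matrix μ μ K} {N : Matrix (Fin (k + 1)) (Fin (k + 1)) K}
    {B : Matrix μ (Fin (k + 1)) K} {X : Matrix (Fin k) μ K} {f : Fin k → K} {b : μ → K}
    (hN : Nᴴ = N)
    (h : PenroseEqs M
      (fromBlocks (N.submatrix Fin.castSucc Fin.castSucc)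
        (replicateCol (Fin 1) fun r => N (Fin.castSucc r) (Fin.last k))
        (replicateCol (Fin 1) fun r => N (Fin.castSucc r) (Fin.last k))ᴴ
        (of fun _ _ => N (Fin.last k) (Fin.last k)))
      (fromCols (B.submatrix id Fin.castSucc) (replicateCol (Fin 1) fun r => B r (Fin.last k)))
      (fromRows (X - replicateCol (Fin 1) f * replicateRow (Fin 1) b) (replicateRow (Fin 1) b))) :
    PenroseEqs M N B (correctedRows X f b) := by
  apply PenroseEqs.of_submatrix (finSumFinEquiv (m := k) (n := 1))
  convert h using 1
  · exact submatrix_finSumFinEquiv_eq_fromBlocks hN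
  · ext i (j | j)
    · rfl
    · rw [submatrix_apply, finSumFinEquiv_inr_one]; rfl
  · ext (i | i) j
    · have : finSumFinEquiv (m := k) (n := 1) (Sum.inl i) = Fin.castSucc i := rfl
      simp [-finSumFinEquiv_apply_left, correctedRows, this, Matrix.mul_apply, vecMulVec_apply]
    · rw [submatrix_apply, finSumFinEquiv_inr_one]
      simp [correctedRows]

theorem IsDefiniteHermitian.submatrix_equiv {κ κ' : Type*} [Fintype κ] [Fintype κ'] (e : κ' ≃ κ)
    {N : Matrix κ κ K} (hN : IsDefiniteHermitian N) : IsDefiniteHermitian (N.submatrix e e) where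
  isHermitian := by rw [conjTranspose_submatrix, hN.isHermitian]
  eq_zero_of_form_eq_zero v hv := by
    have h1 : v ∘ e.symm = 0 := by
      apply hN.eq_zero_of_form_eq_zero
      rw [submatrix_mulVec_equiv] at hv
      change (star v ∘ e.symm) ⬝ᵥ _ = 0
      rwa [comp_equiv_symm_dotProduct]
    ext i
    simpa using congrFun h1 (e i)

theorem col_form {ι : Type*} [Fintype ι] (M : Matrix ι ι K) (v w : ι → K) :
    (replicateCol (Fin 1) v)ᴴ * M * replicateCol (Fin 1) w
      = of fun _ _ => star v ⬝ᵥ (M *ᵥ w) := by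
  rw [Matrix.mul_assoc, ← replicateCol_mulVec, conjTranspose_replicateCol]
  ext i j
  rw [replicateRow_mul_replicateCol_apply, of_apply]

theorem col_dot {ι : Type*} [Fintype ι] (v w : ι → K) :
    (replicateCol (Fin 1) v)ᴴ * replicateCol (Fin 1) w = of fun _ _ => star v ⬝ᵥ w := by
  rw [conjTranspose_replicateCol]
  ext i j
  rw [replicateRow_mul_replicateCol_apply, of_apply]

/-- Bordering by a column `a` outside the column space of the preceding columns: here
`c = a - B d` is not isotropic. -/
theorem PenroseEqs.snoc_of_independent {M : Matrix μ μ K}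
    {N : Matrix (Fin (k + 1)) (Fin (k + 1)) K}
    {B : Matrix μ (Fin (k + 1)) K} {X : Matrix (Fin k) μ K} {Ni : Matrix (Fin k) (Fin k) K}
    {a c b : μ → K} {l d e : Fin k → K}
    (hM : Mᴴ = M) (hN : Nᴴ = N)
    (h : PenroseEqs M (N.submatrix Fin.castSucc Fin.castSucc) (B.submatrix id Fin.castSucc) X)
    (hNi : N.submatrix Fin.castSucc Fin.castSucc * Ni = 1)
    (ha : a = fun r => B r (Fin.last k)) (hl : l = fun r => N (Fin.castSucc r) (Fin.last k))
    (hd : d = X *ᵥ a) (he : e = (1 - X * B.submatrix id Fin.castSucc) *ᵥ (Ni *ᵥ l))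
    (hc : c = a - B.submatrix id Fin.castSucc *ᵥ d)
    (hw : star c ⬝ᵥ (M *ᵥ c) ≠ 0)
    (hb : b = (star c ⬝ᵥ (M *ᵥ c))⁻¹ • (star c ᵥ* M)) :
    PenroseEqs M N B (correctedRows X (d + e) b) := by
  apply PenroseEqs.of_blocks hN
  have hN' : (N.submatrix Fin.castSucc Fin.castSucc)ᴴ = N.submatrix Fin.castSucc Fin.castSucc := by
    rw [conjTranspose_submatrix, hN]
  have hν : (of fun _ _ : Fin 1 => N (Fin.last k) (Fin.last k))ᴴ
      = of fun _ _ => N (Fin.last k) (Fin.last k) := by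
    ext i j
    exact congrFun (congrFun hN (Fin.last k)) (Fin.last k)
  rw [← ha, ← hl]
  have hcc : replicateCol (Fin 1) a - B.submatrix id Fin.castSucc * (X * replicateCol (Fin 1) a)
      = replicateCol (Fin 1) c := by
    rw [hc, hd, ← replicateCol_mulVec, ← replicateCol_mulVec]; rfl
  have key := PenroseEqs.bordered_of_independent (l := replicateCol (Fin 1) l)
    (a := replicateCol (Fin 1) a) (b := replicateRow (Fin 1) b) h hN' hNi hM hν
    (w := star c ⬝ᵥ (M *ᵥ c)) (wi := (star c ⬝ᵥ (M *ᵥ c))⁻¹)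
    (star_form_of_conjTranspose_eq hM c c) (inv_mul_cancel₀ hw) ?_ ?_
  · rw [← replicateCol_mulVec, Matrix.mul_assoc _ Ni, ← replicateCol_mulVec,
      ← replicateCol_mulVec, ← hd, ← he] at key
    exact key
  · rw [hcc, col_form]
    ext i j
    fin_cases i; fin_cases j; simp
  · rw [hcc, hb, conjTranspose_replicateCol, ← replicateRow_vecMul]
    rfl

/-- Bordering by a column `a = B d` in the column space of the preceding columns; `δ` is then
automatically nonzero and self-conjugate. -/
theorem PenroseEqs.snoc_of_dependent {M : Matrix μ μ K}
    {N : Matrix (Fin (k + 1)) (Fin (k + 1)) K}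
    {B : Matrix μ (Fin (k + 1)) K} {X : Matrix (Fin k) μ K} {N₁ Ni : Matrix (Fin k) (Fin k) K}
    {a b : μ → K} {l d e : Fin k → K} {δ : K}
    (hN : IsDefiniteHermitian N) (hN₁ : N₁ = N.submatrix Fin.castSucc Fin.castSucc)
    (h : PenroseEqs M N₁ (B.submatrix id Fin.castSucc) X)
    (hNi : N₁ * Ni = 1)
    (ha : a = fun r => B r (Fin.last k)) (hl : l = fun r => N (Fin.castSucc r) (Fin.last k))
    (hd : d = X *ᵥ a) (he : e = (1 - X * B.submatrix id Fin.castSucc) *ᵥ (Ni *ᵥ l))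
    (hc : a = B.submatrix id Fin.castSucc *ᵥ d)
    (hδ : δ = N (Fin.last k) (Fin.last k) + star d ⬝ᵥ (N₁ *ᵥ d) - star d ⬝ᵥ l - star l ⬝ᵥ d
      - star l ⬝ᵥ e)
    (hb : b = δ⁻¹ • ((star d ᵥ* N₁ - star l) ᵥ* X)) :
    δ ≠ 0 ∧ star δ = δ ∧ PenroseEqs M N B (correctedRows X (d + e) b) := by
  have hN' : N₁ᴴ = N₁ := by
    rw [hN₁, conjTranspose_submatrix, hN.isHermitian]
  have hdm : X * replicateCol (Fin 1) a = replicateCol (Fin 1) d := by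
    rw [hd, ← replicateCol_mulVec]
  have hem : (1 - X * B.submatrix id Fin.castSucc) * Ni * replicateCol (Fin 1) l
      = replicateCol (Fin 1) e := by
    rw [he, Matrix.mul_assoc, ← replicateCol_mulVec, ← replicateCol_mulVec]
  have hδm : δ • (1 : Matrix (Fin 1) (Fin 1) K)
      = (of fun _ _ => N (Fin.last k) (Fin.last k))
        + (X * replicateCol (Fin 1) a)ᴴ * N₁ * (X * replicateCol (Fin 1) a)
        - (X * replicateCol (Fin 1) a)ᴴ * replicateCol (Fin 1) l
        - (replicateCol (Fin 1) l)ᴴ * (X * replicateCol (Fin 1) a)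
        - (replicateCol (Fin 1) l)ᴴ
          * ((1 - X * B.submatrix id Fin.castSucc) * Ni * replicateCol (Fin 1) l) := by
    rw [hdm, hem, col_form, col_dot, col_dot, col_dot, hδ]
    ext i j
    fin_cases i; fin_cases j; simp
  have hform : δ = star (Sum.elim (d + e) (-1 : Fin 1 → K)) ⬝ᵥ
      (N.submatrix (finSumFinEquiv (m := k) (n := 1)) (finSumFinEquiv (m := k) (n := 1))
        *ᵥ Sum.elim (d + e) (-1 : Fin 1 → K)) := by
    have h1 := h.bordered_form_eq (a := replicateCol (Fin 1) a) (l := replicateCol (Fin 1) l)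
      (ν := of fun _ _ => N (Fin.last k) (Fin.last k)) hN' hNi
    have h2 : fromRows (replicateCol (Fin 1) d + replicateCol (Fin 1) e)
          (-1 : Matrix (Fin 1) (Fin 1) K)
        = replicateCol (Fin 1) (Sum.elim (d + e) (-1 : Fin 1 → K)) := by
      ext (i | i) j
      · simp
      · fin_cases i; fin_cases j; simp
    have h3 := submatrix_finSumFinEquiv_eq_fromBlocks hN.isHermitian
    rw [← hN₁, ← hl] at h3
    rw [← hδm, hdm, hem, h2, ← Matrix.mul_assoc, ← h3, col_form] at h1
    simpa using (congrFun (congrFun h1 0) 0).symm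
  have hNe := hN.submatrix_equiv (finSumFinEquiv (m := k) (n := 1))
  have hδ0 : δ ≠ 0 := fun h0 => by
    have := hNe.eq_zero_of_form_eq_zero _ (hform.symm.trans h0)
    simpa using congrFun this (Sum.inr 0)
  have hδs : star δ = δ := by
    rw [hform]
    exact star_form_of_conjTranspose_eq hNe.isHermitian _ _
  refine ⟨hδ0, hδs, PenroseEqs.of_blocks hN.isHermitian ?_⟩
  rw [← ha, ← hl, ← hN₁]
  have key := h.bordered_of_dependent (b := replicateRow (Fin 1) b) hN' hNi
    (by rw [hdm, ← replicateCol_mulVec, ← hc]) hδs (inv_mul_cancel₀ hδ0) hδm ?_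
  · rw [hdm, hem] at key
    exact key
  · rw [hb, hdm, conjTranspose_replicateCol, conjTranspose_replicateCol, ← replicateRow_vecMul]
    have : replicateRow (Fin 1) (star d ᵥ* N₁) - replicateRow (Fin 1) (star l)
        = replicateRow (Fin 1) (star d ᵥ* N₁ - star l) := rfl
    rw [this, ← replicateRow_vecMul]
    rfl

end OneColumn

/-! ### The bordering step without fractions -/

noncomputable section FractionFree

/-- The data of one step with denominators cleared, over a commutative ring: the weight `M`; the
bordered weight with blocks `N`, `l`, `ν`; the preceding columns `B` and the new column `a`; the
inverse of `N`, written `Nb / β`; the preceding weighted Moore-Penrose inverse, written `Z / y`. -/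
structure StepData (R : Type*) (μ : Type*) (k : ℕ) where
  M : Matrix μ μ R
  N : Matrix (Fin k) (Fin k) R
  l : Fin k → R
  ν : R
  B : Matrix μ (Fin k) R
  a : μ → R
  Nb : Matrix (Fin k) (Fin k) R
  β : R
  Z : Matrix (Fin k) μ R
  y : R

namespace StepData

variable {R : Type*} [CommRing R] {μ : Type*} {k : ℕ} (D : StepData R μ k)

/-- Apply a ring homomorphism to all entries. -/
def map {S : Type*} [CommRing S] (f : R →+* S) : StepData S μ k where
  M := D.M.map f
  N := D.N.map f
  l := f ∘ D.l
  ν := f D.ν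
  B := D.B.map f
  a := f ∘ D.a
  Nb := D.Nb.map f
  β := f D.β
  Z := D.Z.map f
  y := f D.y

/-- The common denominator `y β` of `d / y` and `φ / (y β)`. -/
def psi : R := D.y * D.β

/-- `y² β`, the denominator of `δ`, and so the numerator of `δ⁻¹`. -/
def Delta1 : R := D.y * D.y * D.β

variable [Fintype μ]

/-- `y` times `d = X a`. -/
def d : Fin k → R := D.Z *ᵥ D.a

/-- `y` times `c = a - B X a`. -/
def c : μ → R := D.y • D.a - D.B *ᵥ D.d

/-- `y β` times the correction `e = (I - X B) N⁻¹ l`. -/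
def phi : Fin k → R := (D.y • (1 : Matrix (Fin k) (Fin k) R) - D.Z * D.B) *ᵥ (D.Nb *ᵥ D.l)

section Star

variable [StarRing R]

/-- `y² β` times `δ`, provided that `y` is self-conjugate. -/
def Delta2 : R :=
  (D.ν * D.y * D.y + star D.d ⬝ᵥ (D.N *ᵥ D.d) - (star D.d ⬝ᵥ D.l) * D.y
    - (star D.l ⬝ᵥ D.d) * D.y) * D.β - (star D.l ⬝ᵥ D.phi) * D.y

open Classical in
/-- The numerator of the last row `b = V / W` of the new inverse. -/
def V : μ → R :=
  if D.c = 0 then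
    D.Delta1 • ((star D.d ᵥ* D.N) ᵥ* D.Z) - (D.Delta1 * D.y) • (star D.l ᵥ* D.Z)
  else D.y • (star D.c ᵥ* D.M)

open Classical in
/-- The denominator of the last row `b = V / W` of the new inverse. -/
def W : R := if D.c = 0 then D.Delta2 * D.y * D.y else star D.c ⬝ᵥ (D.M *ᵥ D.c)

/-- `y β W` times the rows of `X - (d + e) b`. -/
def Theta : Matrix (Fin k) μ R :=
  (D.β * D.W) • D.Z - D.β • vecMulVec D.d D.V - vecMulVec D.phi D.V

/-- The numerator of the new inverse. -/
def nextZ : Matrix (Fin (k + 1)) μ R :=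
  of (Fin.snoc (α := fun _ => μ → R) (fun r => D.Theta r) (D.psi • D.V))

/-- The denominator of the new inverse. -/
def nextY : R := D.psi * D.W

end Star

section Map

variable {S : Type*} [CommRing S] (f : R →+* S)

theorem comp_mulVec {ι κ : Type*} [Fintype κ]
    (A : Matrix ι κ R) (v : κ → R) :
    f ∘ (A *ᵥ v) = A.map f *ᵥ (f ∘ v) := funext fun i => RingHom.map_mulVec f A v i

theorem comp_vecMul {ι κ : Type*} [Fintype ι] (A : Matrix ι κ R) (v : ι → R) :
    f ∘ (v ᵥ* A) = (f ∘ v) ᵥ* A.map f := funext fun i => RingHom.map_vecMul f A v i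

theorem comp_smul {ι : Type*} (r : R) (v : ι → R) :
    f ∘ (r • v) = f r • (f ∘ v) := by ext; simp

theorem comp_sub {ι : Type*} (v w : ι → R) : f ∘ (v - w) = f ∘ v - f ∘ w := by ext; simp

omit [Fintype μ] in
theorem map_psi : (D.map f).psi = f D.psi := (map_mul f _ _).symm

omit [Fintype μ] in
theorem map_Delta1 : (D.map f).Delta1 = f D.Delta1 := by simp [Delta1, map]

theorem map_d : (D.map f).d = f ∘ D.d := (comp_mulVec f _ _).symm

theorem map_c : (D.map f).c = f ∘ D.c := by
  rw [c, c, comp_sub, comp_smul, comp_mulVec, map_d]; rfl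

theorem map_c_eq_zero_iff (hinj : Function.Injective f) : (D.map f).c = 0 ↔ D.c = 0 := by
  rw [map_c]
  constructor
  · intro h
    ext i
    exact hinj (by simpa using congrFun h i)
  · intro h
    ext i
    simp [h]

theorem map_phi : (D.map f).phi = f ∘ D.phi := by
  rw [phi, phi, comp_mulVec, comp_mulVec]
  congr 1
  ext i j
  by_cases hij : i = j <;> simp [map, Matrix.mul_apply, hij]

variable [StarRing R] [StarRing S] (hf : ∀ x, f (star x) = star (f x))
include hf

theorem comp_star {ι : Type*} (v : ι → R) : f ∘ star v = star (f ∘ v) := funext fun _ => hf _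

theorem map_Delta2 : (D.map f).Delta2 = f D.Delta2 := by
  simp only [Delta2, map_sub, map_mul, map_add, map_d, map_phi, RingHom.map_dotProduct,
    comp_mulVec, comp_star f hf]
  rfl

variable (hinj : Function.Injective f)
include hinj

theorem map_V : (D.map f).V = f ∘ D.V := by
  rw [V, V]
  by_cases hc : D.c = 0
  · rw [if_pos hc, if_pos ((D.map_c_eq_zero_iff f hinj).mpr hc)]
    simp only [comp_sub, comp_smul, comp_vecMul, comp_star f hf, map_Delta1, map_d, map_mul]
    rfl
  · rw [if_neg hc, if_neg (mt (D.map_c_eq_zero_iff f hinj).mp hc)]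
    simp only [comp_smul, comp_vecMul, comp_star f hf, map_c]
    rfl

theorem map_W : (D.map f).W = f D.W := by
  rw [W, W]
  by_cases hc : D.c = 0
  · rw [if_pos hc, if_pos ((D.map_c_eq_zero_iff f hinj).mpr hc), map_mul, map_mul,
      D.map_Delta2 f hf]
    rfl
  · rw [if_neg hc, if_neg (mt (D.map_c_eq_zero_iff f hinj).mp hc), RingHom.map_dotProduct,
      comp_mulVec, comp_star f hf, map_c]
    rfl

theorem map_nextY : (D.map f).nextY = f D.nextY := by
  rw [nextY, nextY, map_mul, D.map_W f hf hinj, map_psi]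

theorem map_nextZ : (D.map f).nextZ = D.nextZ.map f := by
  ext i j
  refine Fin.lastCases ?_ (fun i => ?_) i
  · simp [nextZ, map_psi, D.map_V f hf hinj]
  · simp only [nextZ, Theta, D.map_V f hf hinj, D.map_W f hf hinj, map_d, map_phi, of_apply,
      Fin.snoc_castSucc, Matrix.sub_apply, Matrix.smul_apply, vecMulVec_apply, smul_eq_mul,
      Matrix.map_apply, map_sub, map_mul]
    rfl

end Map

section Field

variable {K : Type*} [Field K] [StarRing K] (D : StepData K μ k)

/-- Over a field, a step with definite weights turns the weighted Moore-Penrose inverse of the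
preceding columns into that of all columns.  The new denominator is again nonzero and
self-conjugate. -/
theorem penroseEqs_next {N : Matrix (Fin (k + 1)) (Fin (k + 1)) K} {B : Matrix μ (Fin (k + 1)) K}
    (hM : IsDefiniteHermitian D.M) (hN : IsDefiniteHermitian N)
    (hNsub : D.N = N.submatrix Fin.castSucc Fin.castSucc)
    (hBsub : D.B = B.submatrix id Fin.castSucc)
    (ha : D.a = fun r => B r (Fin.last k)) (hl : D.l = fun r => N (Fin.castSucc r) (Fin.last k))
    (hν : D.ν = N (Fin.last k) (Fin.last k))
    (hy : D.y ≠ 0) (hys : star D.y = D.y) (hβ : D.β ≠ 0) (hβs : star D.β = D.β)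
    (hinv : D.N * (D.β⁻¹ • D.Nb) = 1)
    (h : PenroseEqs D.M D.N D.B (D.y⁻¹ • D.Z)) :
    D.nextY ≠ 0 ∧ star D.nextY = D.nextY ∧ PenroseEqs D.M N B (D.nextY⁻¹ • D.nextZ) := by
  have hd : D.y⁻¹ • D.d = (D.y⁻¹ • D.Z) *ᵥ D.a := by rw [smul_mulVec]; rfl
  have he : (D.y * D.β)⁻¹ • D.phi
      = (1 - D.y⁻¹ • D.Z * D.B) *ᵥ ((D.β⁻¹ • D.Nb) *ᵥ D.l) := by
    have h1 : (1 : Matrix (Fin k) (Fin k) K) - D.y⁻¹ • D.Z * D.B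
        = D.y⁻¹ • (D.y • (1 : Matrix (Fin k) (Fin k) K) - D.Z * D.B) := by
      rw [smul_sub, smul_smul, inv_mul_cancel₀ hy, one_smul, Matrix.smul_mul]
    rw [h1, smul_mulVec, smul_mulVec, mulVec_smul, smul_smul, mul_inv]
    rfl
  have hcorr : D.W ≠ 0 → D.nextY⁻¹ • D.nextZ
      = correctedRows (D.y⁻¹ • D.Z) (D.y⁻¹ • D.d + (D.y * D.β)⁻¹ • D.phi) (D.W⁻¹ • D.V) := by
    intro hW
    ext i j
    refine Fin.lastCases ?_ (fun i => ?_) i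
    · simp only [nextZ, nextY, psi, correctedRows, Matrix.smul_apply, of_apply, Fin.snoc_last,
        Pi.smul_apply, smul_eq_mul]
      field_simp
    · simp only [nextZ, nextY, psi, correctedRows, Matrix.smul_apply, of_apply, Fin.snoc_castSucc,
        Pi.smul_apply, smul_eq_mul, Theta, Matrix.sub_apply, vecMulVec_apply, Pi.add_apply]
      field_simp
      ring
  by_cases hc : D.c = 0
  · have hc' : D.a = B.submatrix id Fin.castSucc *ᵥ (D.y⁻¹ • D.d) := by
      have h1 : D.y • D.a = D.B *ᵥ D.d := sub_eq_zero.mp hc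
      rw [← hBsub, mulVec_smul, ← h1, smul_smul, inv_mul_cancel₀ hy, one_smul]
    have hyi : star D.y⁻¹ = D.y⁻¹ := by rw [star_inv₀, hys]
    rw [hBsub] at h he
    have hδ : D.Delta2 / (D.y * D.y * D.β) = N (Fin.last k) (Fin.last k)
        + star (D.y⁻¹ • D.d) ⬝ᵥ (D.N *ᵥ (D.y⁻¹ • D.d)) - star (D.y⁻¹ • D.d) ⬝ᵥ D.l
        - star D.l ⬝ᵥ (D.y⁻¹ • D.d) - star D.l ⬝ᵥ ((D.y * D.β)⁻¹ • D.phi) := by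
      rw [← hν, Delta2]
      simp only [star_smul, hyi, mulVec_smul, smul_dotProduct, dotProduct_smul, smul_eq_mul]
      field_simp
    have hb : D.W⁻¹ • D.V = (D.Delta2 / (D.y * D.y * D.β))⁻¹
        • ((star (D.y⁻¹ • D.d) ᵥ* D.N - star D.l) ᵥ* (D.y⁻¹ • D.Z)) := by
      have hV : D.V = (D.y * D.y * D.β) • ((star D.d ᵥ* D.N) ᵥ* D.Z)
          - (D.y * D.y * D.β * D.y) • (star D.l ᵥ* D.Z) := if_pos hc
      have hW : D.W = D.Delta2 * D.y * D.y := if_pos hc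
      rw [hV, hW, star_smul, hyi, smul_vecMul, vecMul_smul, sub_vecMul, smul_vecMul]
      ext j
      simp only [Pi.smul_apply, Pi.sub_apply, smul_eq_mul]
      -- If `Δ₂ = 0`, both sides are zero by the convention `0⁻¹ = 0`.
      by_cases hΔ : D.Delta2 = 0
      · simp [hΔ]
      · field_simp
    obtain ⟨hδ0, hδs, hP⟩ :=
      PenroseEqs.snoc_of_dependent hN hNsub h hinv ha hl hd he hc' hδ hb
    have hΔ : D.Delta2 ≠ 0 := fun h0 => hδ0 (by rw [h0, zero_div])
    have hW : D.W = D.Delta2 * D.y * D.y := if_pos hc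
    have hW0 : D.W ≠ 0 := by rw [hW]; exact mul_ne_zero (mul_ne_zero hΔ hy) hy
    have hΔs : star D.Delta2 = D.Delta2 := by
      have h2 : D.Delta2 = D.Delta2 / (D.y * D.y * D.β) * (D.y * D.y * D.β) := by field_simp
      rw [h2, star_mul', hδs]
      simp only [star_mul', hys, hβs]
    refine ⟨mul_ne_zero (mul_ne_zero hy hβ) hW0, ?_, ?_⟩
    · rw [nextY, psi, hW]
      simp only [star_mul', hys, hβs, hΔs]
    · rw [hcorr hW0]
      exact hP
  · have hyi : star D.y⁻¹ = D.y⁻¹ := by rw [star_inv₀, hys]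
    have hW : D.W = star D.c ⬝ᵥ (D.M *ᵥ D.c) := if_neg hc
    have hW0 : D.W ≠ 0 := fun h0 => hc (hM.eq_zero_of_form_eq_zero _ (hW ▸ h0))
    have hV : D.V = D.y • (star D.c ᵥ* D.M) := if_neg hc
    have hc' : D.y⁻¹ • D.c = D.a - B.submatrix id Fin.castSucc *ᵥ (D.y⁻¹ • D.d) := by
      rw [← hBsub, mulVec_smul, c, smul_sub, smul_smul, inv_mul_cancel₀ hy, one_smul]
    have hform : star (D.y⁻¹ • D.c) ⬝ᵥ (D.M *ᵥ (D.y⁻¹ • D.c)) = D.y⁻¹ * (D.y⁻¹ * D.W) := by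
      rw [hW, star_smul, hyi, mulVec_smul, smul_dotProduct, dotProduct_smul]; rfl
    refine ⟨mul_ne_zero (mul_ne_zero hy hβ) hW0, ?_, ?_⟩
    · rw [nextY, psi, hW]
      simp only [star_mul', hys, hβs, star_form_of_conjTranspose_eq hM.isHermitian]
    · rw [hcorr hW0]
      rw [hBsub] at h he
      rw [hNsub] at h hinv
      refine PenroseEqs.snoc_of_independent hM.isHermitian hN.isHermitian h hinv ha hl hd he hc'
        ?_ ?_
      · rw [hform]
        exact mul_ne_zero (inv_ne_zero hy) (mul_ne_zero (inv_ne_zero hy) hW0)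
      · rw [hform, hV, star_smul, hyi, smul_vecMul]
        ext j
        simp only [Pi.smul_apply, smul_eq_mul]
        field_simp

end Field
end StepData
end FractionFree

/-! ### Coefficients of products of polynomial matrices -/

noncomputable section Coefficients

/-- Conjugation of the coefficients, the star that `algebraMap ℂ[X] (RatFunc ℂ)` carries to the one
on `ℂ(s)`. -/
instance polynomialStarRing : StarRing ℂ[X] where
  star p := p.map (starRingEnd ℂ)
  star_involutive p := by
    change (p.map _).map _ = p
    rw [Polynomial.map_map]
    simp
  star_mul p q := by
    change (p * q).map _ = q.map _ * p.map _
    rw [Polynomial.map_mul, mul_comm]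
  star_add p q := Polynomial.map_add _

theorem coeff_star (p : ℂ[X]) (j : ℕ) : (star p).coeff j = star (p.coeff j) :=
  Polynomial.coeff_map _ _

theorem natDegree_star_le (p : ℂ[X]) : (star p).natDegree ≤ p.natDegree :=
  Polynomial.natDegree_map_le

theorem coeffMat_apply {α β : Type*} (P : Matrix α β ℂ[X]) (j : ℕ) (x : α) (y : β) :
    coeffMat P j x y = (P x y).coeff j := rfl

section Sums

variable {α β : Type*} [AddCommMonoid β] (j : ℕ)

theorem sum1_apply (f : ℕ → α → β) (x : α) : sum1 j f x = sum1 j fun k => f k x :=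
  Finset.sum_apply _ _ _

theorem sum2_apply (f : ℕ → ℕ → α → β) (x : α) : sum2 j f x = sum2 j fun r k => f r k x := by
  simp only [sum2, Finset.sum_apply]

theorem sum3_apply (f : ℕ → ℕ → ℕ → α → β) (x : α) :
    sum3 j f x = sum3 j fun t r k => f t r k x := by
  simp only [sum3, Finset.sum_apply]

variable {ι : Type*} (s : Finset ι)

theorem sum1_sum (f : ℕ → ι → β) :
    sum1 j (fun k => ∑ x ∈ s, f k x) = ∑ x ∈ s, sum1 j fun k => f k x :=
  Finset.sum_comm

theorem sum2_sum (f : ℕ → ℕ → ι → β) :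
    sum2 j (fun r k => ∑ x ∈ s, f r k x) = ∑ x ∈ s, sum2 j fun r k => f r k x := by
  unfold sum2
  rw [Finset.sum_comm]
  exact Finset.sum_congr rfl fun r _ => Finset.sum_comm

theorem sum3_sum (f : ℕ → ℕ → ℕ → ι → β) :
    sum3 j (fun t r k => ∑ x ∈ s, f t r k x) = ∑ x ∈ s, sum3 j fun t r k => f t r k x := by
  unfold sum3
  rw [Finset.sum_comm]
  refine Finset.sum_congr rfl fun t _ => ?_
  rw [Finset.sum_comm]
  exact Finset.sum_congr rfl fun r _ => Finset.sum_comm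

theorem sum3_add (f g : ℕ → ℕ → ℕ → β) :
    sum3 j (fun t r k => f t r k + g t r k) = sum3 j f + sum3 j g := by
  simp only [sum3, Finset.sum_add_distrib]

variable {γ : Type*} [AddCommGroup γ]

theorem sum1_sub (f g : ℕ → γ) : sum1 j (fun k => f k - g k) = sum1 j f - sum1 j g := by
  simp only [sum1, Finset.sum_sub_distrib]

theorem sum2_sub (f g : ℕ → ℕ → γ) :
    sum2 j (fun r k => f r k - g r k) = sum2 j f - sum2 j g := by
  simp only [sum2, Finset.sum_sub_distrib]

theorem sum3_sub (f g : ℕ → ℕ → ℕ → γ) :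
    sum3 j (fun t r k => f t r k - g t r k) = sum3 j f - sum3 j g := by
  simp only [sum3, Finset.sum_sub_distrib]

end Sums

/-! The Cauchy products below differ only in the order of the factors. -/

section Cauchy

variable (p q u v : ℂ[X]) (j : ℕ)

theorem sum1_coeff : sum1 j (fun k => p.coeff (j - k) * q.coeff k) = (p * q).coeff j := by
  rw [mul_comm, Polynomial.coeff_mul, Finset.Nat.sum_antidiagonal_eq_sum_range_succ_mk]
  exact Finset.sum_congr rfl fun k _ => mul_comm _ _

theorem sum1_coeff' : sum1 j (fun k => q.coeff k * p.coeff (j - k)) = (q * p).coeff j := by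
  rw [mul_comm, ← sum1_coeff]
  simp only [mul_comm]

theorem sum2_coeff : sum2 j (fun r k => p.coeff (j - k - r) * (q.coeff k * u.coeff r))
    = (p * (q * u)).coeff j := by
  rw [← mul_assoc, ← sum1_coeff]
  refine Finset.sum_congr rfl fun r _ => ?_
  beta_reduce
  rw [← sum1_coeff, sum1, Finset.sum_mul]
  refine Finset.sum_congr rfl fun k _ => ?_
  rw [Nat.sub_right_comm, mul_assoc]

theorem sum2_coeff_right : sum2 j (fun r k => q.coeff k * (u.coeff r * p.coeff (j - k - r)))
    = (q * (u * p)).coeff j := by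
  rw [show q * (u * p) = p * (q * u) by ring, ← sum2_coeff]
  exact congrArg (sum2 j) (funext₂ fun r k => by ring)

theorem sum2_coeff_mid : sum2 j (fun r k => q.coeff k * (p.coeff (j - k - r) * u.coeff r))
    = (q * (p * u)).coeff j := by
  rw [show q * (p * u) = p * (q * u) by ring, ← sum2_coeff]
  exact congrArg (sum2 j) (funext₂ fun r k => by ring)

theorem sum3_coeff :
    sum3 j (fun t r k => p.coeff (j - k - r - t) * (q.coeff k * (u.coeff r * v.coeff t)))
      = (p * (q * (u * v))).coeff j := by
  rw [show p * (q * (u * v)) = p * (q * u) * v by ring, ← sum1_coeff]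
  refine Finset.sum_congr rfl fun t _ => ?_
  beta_reduce
  rw [← sum2_coeff, sum2, Finset.sum_mul]
  refine Finset.sum_congr rfl fun r _ => ?_
  rw [Finset.sum_mul]
  refine Finset.sum_congr rfl fun k _ => ?_
  rw [show j - k - r - t = j - t - k - r by omega]
  ring

theorem sum3_coeff_reverse :
    sum3 j (fun t r k => p.coeff (j - k - r - t) * (v.coeff t * (u.coeff r * q.coeff k)))
      = (p * (v * (u * q))).coeff j := by
  rw [show p * (v * (u * q)) = p * (q * (u * v)) by ring, ← sum3_coeff]
  exact congrArg (sum3 j) (funext₃ fun t r k => by ring)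

theorem sum3_coeff_rotate :
    sum3 j (fun t r k => p.coeff (j - k - r - t) * (u.coeff r * (v.coeff t * q.coeff k)))
      = (p * (u * (v * q))).coeff j := by
  rw [show p * (u * (v * q)) = p * (q * (u * v)) by ring, ← sum3_coeff]
  exact congrArg (sum3 j) (funext₃ fun t r k => by ring)

end Cauchy

theorem upTo_eq {α : Type*} [Zero α] {b : ℕ} {f g : ℕ → α} (hfg : ∀ j, f j = g j)
    (hg : ∀ j, b < j → g j = 0) (j : ℕ) : upTo b f j = g j := by
  unfold upTo
  split_ifs with h
  · exact hfg j
  · exact (hg j (not_le.mp h)).symm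

theorem upTo_eq_coeff {b : ℕ} {f : ℕ → ℂ} {p : ℂ[X]} (hf : ∀ j, f j = p.coeff j)
    (hp : p.natDegree ≤ b) (j : ℕ) : upTo b f j = p.coeff j :=
  upTo_eq hf (fun _ hj => coeff_eq_zero_of_natDegree_lt (hp.trans_lt hj)) j

theorem upTo_eq_coeffVec {ι : Type*} {b : ℕ} {f : ℕ → ι → ℂ} {p : ι → ℂ[X]}
    (hf : ∀ j x, f j x = (p x).coeff j) (hp : ∀ x, (p x).natDegree ≤ b) (j : ℕ) :
    upTo b f j = fun x => (p x).coeff j :=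
  upTo_eq (g := fun j x => (p x).coeff j) (fun j => funext (hf j))
    (fun _ hj => funext fun x => coeff_eq_zero_of_natDegree_lt ((hp x).trans_lt hj)) j

theorem upTo_eq_coeffMat {ι κ : Type*} {b : ℕ} {f : ℕ → Matrix ι κ ℂ} {P : Matrix ι κ ℂ[X]}
    (hf : ∀ j x y, f j x y = (P x y).coeff j) (hP : ∀ x y, (P x y).natDegree ≤ b) (j : ℕ) :
    upTo b f j = coeffMat P j :=
  upTo_eq (g := coeffMat P) (fun j => Matrix.ext (hf j))
    (fun _ hj => Matrix.ext fun x y => coeff_eq_zero_of_natDegree_lt ((hP x y).trans_lt hj)) j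

/-! ### Degree bounds and one step of the algorithm -/

section Degrees

theorem natDegree_sub_le_max {p q : ℂ[X]} {b : ℕ} (hp : p.natDegree ≤ b) (hq : q.natDegree ≤ b) :
    (p - q).natDegree ≤ b := (natDegree_sub_le p q).trans (max_le hp hq)

theorem natDegree_add_le_max {p q : ℂ[X]} {b : ℕ} (hp : p.natDegree ≤ b) (hq : q.natDegree ≤ b) :
    (p + q).natDegree ≤ b := (natDegree_add_le p q).trans (max_le hp hq)

theorem natDegree_mul_le_add {p q : ℂ[X]} {a b n : ℕ} (hp : p.natDegree ≤ a)
    (hq : q.natDegree ≤ b) (hn : a + b ≤ n) : (p * q).natDegree ≤ n :=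
  (natDegree_mul_le_of_le hp hq).trans hn

theorem natDegree_dotProduct_le {ι : Type*} [Fintype ι] {v w : ι → ℂ[X]} {a b n : ℕ}
    (hv : ∀ i, (v i).natDegree ≤ a) (hw : ∀ i, (w i).natDegree ≤ b) (hn : a + b ≤ n) :
    (v ⬝ᵥ w).natDegree ≤ n :=
  natDegree_sum_le_of_forall_le _ _ fun i _ => natDegree_mul_le_add (hv i) (hw i) hn

theorem natDegree_star_apply_le {ι : Type*} {v : ι → ℂ[X]} {a : ℕ}
    (hv : ∀ i, (v i).natDegree ≤ a) (i : ι) : (star v i).natDegree ≤ a :=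
  (natDegree_star_le _).trans (hv i)

end Degrees

variable {m n : ℕ}

/-- `S` holds the coefficients of the polynomial matrix `Z` and of the polynomial `y`. -/
structure Stage.Represents {k : ℕ} (S : Stage m k) (Z : Matrix (Fin k) (Fin m) ℂ[X]) (y : ℂ[X]) :
    Prop where
  coeff_Z : ∀ j, S.Z j = coeffMat Z j
  coeff_Y : ∀ j, S.Y j = y.coeff j
  natDegree_Z : ∀ r c, (Z r c).natDegree ≤ S.q
  natDegree_Y : y.natDegree ≤ S.p

theorem Stage.Represents.num_eq {k : ℕ} {S : Stage m k} {Z : Matrix (Fin k) (Fin m) ℂ[X]}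
    {y : ℂ[X]} (h : S.Represents Z y) : S.num = Z := by
  ext1 r c
  rw [(Z r c).as_sum_range_C_mul_X_pow' (Nat.lt_succ_of_le (h.natDegree_Z r c)), Stage.num,
    Matrix.sum_apply]
  refine Finset.sum_congr rfl fun j _ => ?_
  rw [h.coeff_Z, Matrix.smul_apply, Matrix.map_apply, coeffMat_apply, smul_eq_mul, mul_comm]

theorem Stage.Represents.den_eq {k : ℕ} {S : Stage m k} {Z : Matrix (Fin k) (Fin m) ℂ[X]}
    {y : ℂ[X]} (h : S.Represents Z y) : S.den = y := by
  rw [y.as_sum_range_C_mul_X_pow' (Nat.lt_succ_of_le h.natDegree_Y), Stage.den]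
  simp only [h.coeff_Y]

namespace Input

variable (D : Input m n) {k : ℕ} (hk : k < n) (S : Stage m k)

/-- The data of the step that adds the column with zero-based number `k`, when the preceding stage
represents `Z / y`. -/
def stepData (Z : Matrix (Fin k) (Fin m) ℂ[X]) (y : ℂ[X]) : StepData ℂ[X] (Fin m) k where
  M := D.M
  N := leadPrincipal D.N k hk.le
  l := fun r => D.N (Fin.castLE hk.le r) ⟨k, hk⟩
  ν := D.N ⟨k, hk⟩ ⟨k, hk⟩
  B := leadCols D.A k hk.le
  a := fun r => D.A r ⟨k, hk⟩
  Nb := D.Nnum k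
  β := D.Nden k
  Z := Z
  y := y

/-- The entries that enter the step from `k` to `k + 1` columns respect the degree bounds of the
input. -/
structure DegreeBounds (D : Input m n) (k : ℕ) : Prop where
  A : ∀ r c, (D.A r c).natDegree ≤ D.q
  M : ∀ r c, (D.M r c).natDegree ≤ D.mq
  N : ∀ r c, (D.N r c).natDegree ≤ D.nq
  Nnum : ∀ r c, (D.Nnum k r c).natDegree ≤ D.nnum k
  Nden : (D.Nden k).natDegree ≤ D.nden k

variable {D S} {Z : Matrix (Fin k) (Fin m) ℂ[X]} {y : ℂ[X]} (hD : D.DegreeBounds k)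
  (hS : S.Represents Z y)
include hD hS

theorem natDegree_d (i : Fin k) : ((D.stepData hk Z y).d i).natDegree ≤ S.q + D.q :=
  natDegree_dotProduct_le (hS.natDegree_Z i) (fun _ => hD.A _ _) le_rfl

theorem d_eq (j : ℕ) : D.d k hk S j = fun i => ((D.stepData hk Z y).d i).coeff j := by
  refine upTo_eq_coeffVec (fun j i => ?_) (natDegree_d hk hD hS) j
  simp only [sum1_apply, mulVec, dotProduct, hS.coeff_Z, coeffMat_apply, col, sum1_sum, sum1_coeff,
    StepData.d, finsetSum_coeff, stepData]

theorem natDegree_c (i : Fin m) : ((D.stepData hk Z y).c i).natDegree ≤ D.qhat k S + D.q := by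
  have h1 : S.p ≤ D.qhat k S := le_max_left _ _
  have h2 : S.q + D.q ≤ D.qhat k S := le_max_right _ _
  refine natDegree_sub_le_max ?_ ?_
  · exact natDegree_mul_le_add hS.natDegree_Y (hD.A _ _) (by omega)
  · exact natDegree_dotProduct_le (fun _ => hD.A _ _) (natDegree_d hk hD hS) (by omega)

theorem c_eq (j : ℕ) : D.c k hk S j = fun i => ((D.stepData hk Z y).c i).coeff j := by
  refine upTo_eq_coeffVec (fun j i => ?_) (natDegree_c hk hD hS) j
  simp only [sum1_apply, mulVec, dotProduct, hS.coeff_Y, coeffMat_apply, col, Ahat, d_eq hk hD hS,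
    sum1_sum, sum1_coeff, sum1_coeff', sum1_sub, Pi.sub_apply, Pi.smul_apply, smul_eq_mul,
    StepData.c, finsetSum_coeff, coeff_sub]
  rfl

/-- The coefficients of `c` beyond the tested range vanish, so that the test of the algorithm
decides whether the polynomial vector `c` is zero. -/
theorem cNonzero_iff : D.cNonzero k hk S ↔ (D.stepData hk Z y).c ≠ 0 := by
  constructor
  · rintro ⟨j, -, hj⟩ h
    rw [c_eq hk hD hS, h] at hj
    exact hj (by ext; simp)
  · intro h
    by_contra hc
    refine h (funext fun i => Polynomial.ext fun j => ?_)
    by_cases hj : j ≤ D.qhat k S + D.q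
    · have h1 : D.c k hk S j = 0 := by
        by_contra h2
        exact hc ⟨j, hj, h2⟩
      rw [c_eq hk hD hS] at h1
      simpa using congrFun h1 i
    · rw [coeff_eq_zero_of_natDegree_lt ((natDegree_c hk hD hS i).trans_lt (not_le.mp hj))]
      rfl

theorem natDegree_phi (i : Fin k) :
    ((D.stepData hk Z y).phi i).natDegree ≤ D.qhat k S + D.nnum k + D.nq := by
  have h1 : S.p ≤ D.qhat k S := le_max_left _ _
  have h2 : S.q + D.q ≤ D.qhat k S := le_max_right _ _
  change ((fun x => (y • (1 : Matrix (Fin k) (Fin k) ℂ[X]) - Z * leadCols D.A k hk.le) i x) ⬝ᵥ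
    (D.Nnum k *ᵥ fun r => D.N (Fin.castLE hk.le r) ⟨k, hk⟩)).natDegree ≤ _
  refine natDegree_dotProduct_le (a := D.qhat k S) (b := D.nnum k + D.nq)
    (fun x => ?_) (fun x => ?_) (by omega)
  · refine natDegree_sub_le_max ?_ ?_
    · refine natDegree_mul_le_add hS.natDegree_Y (b := 0) ?_ (by omega)
      rw [Matrix.one_apply]
      split_ifs <;> simp
    · exact natDegree_dotProduct_le (hS.natDegree_Z i) (fun _ => hD.A _ _) h2
  · exact natDegree_dotProduct_le (hD.Nnum x) (fun _ => hD.N _ _) le_rfl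

omit hD hS in
theorem idCoeff_apply (j : ℕ) (x z : Fin k) :
    idCoeff k j x z = ((1 : Matrix (Fin k) (Fin k) ℂ[X]) x z).coeff j := by
  rw [idCoeff, Matrix.one_apply]
  by_cases hj : j = 0 <;> by_cases hx : x = z <;>
    simp [hj, hx, Polynomial.coeff_one, Matrix.one_apply]

theorem phi_eq (j : ℕ) : D.phi k hk S j = fun i => ((D.stepData hk Z y).phi i).coeff j := by
  refine upTo_eq_coeffVec (fun j i => ?_) (natDegree_phi hk hD hS) j
  simp only [sum3_apply, mulVec, dotProduct, hS.coeff_Y, hS.coeff_Z, coeffMat_apply, L, Ahat, Nbar,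
    Matrix.sub_apply, Matrix.smul_apply, Matrix.mul_apply, idCoeff_apply, smul_eq_mul,
    Finset.mul_sum, Finset.sum_mul, sub_mul, mul_assoc, sum3_sum, sum3_sub, sum3_coeff,
    Finset.sum_sub_distrib,
    StepData.phi, finsetSum_coeff, coeff_sub]
  rfl

omit hD in
theorem psi_eq (hden : (D.Nden k).natDegree ≤ D.nden k) (j : ℕ) :
    D.psi k S j = (D.stepData hk Z y).psi.coeff j := by
  refine upTo_eq_coeff (fun j => ?_)
    (natDegree_mul_le_add hS.natDegree_Y hden le_rfl) j
  simp only [hS.coeff_Y, Nbarbar, sum1_coeff]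

theorem natDegree_Delta1 : (D.stepData hk Z y).Delta1.natDegree ≤ 2 * S.p + D.nden k :=
  natDegree_mul_le_add (natDegree_mul_le_add hS.natDegree_Y hS.natDegree_Y le_rfl) hD.Nden
    (by omega)

theorem Delta1_eq (j : ℕ) : D.Delta1 k S j = (D.stepData hk Z y).Delta1.coeff j := by
  refine upTo_eq_coeff (fun j => ?_) (natDegree_Delta1 hk hD hS) j
  simp only [hS.coeff_Y, Nbarbar, mul_assoc, sum2_coeff, StepData.Delta1]
  rfl

theorem natDegree_Delta2 : (D.stepData hk Z y).Delta2.natDegree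
    ≤ 2 * D.qhat k S + D.nq + max (D.nq + D.nnum k) (D.nden k) := by
  have h1 : S.p ≤ D.qhat k S := le_max_left _ _
  have h2 : S.q + D.q ≤ D.qhat k S := le_max_right _ _
  have hd := natDegree_d hk hD hS
  have hsd := natDegree_star_apply_le hd
  have hl : ∀ x, ((D.stepData hk Z y).l x).natDegree ≤ D.nq := fun x => hD.N _ _
  have hsl := natDegree_star_apply_le hl
  have hy : (D.stepData hk Z y).y.natDegree ≤ S.p := hS.natDegree_Y
  refine natDegree_sub_le_max (natDegree_mul_le_add (a := 2 * D.qhat k S + D.nq)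
    (natDegree_sub_le_max (natDegree_sub_le_max (natDegree_add_le_max ?_ ?_) ?_) ?_) hD.Nden
    (by omega)) ?_
  · exact natDegree_mul_le_add (natDegree_mul_le_add (hD.N _ _) hy le_rfl) hy (by omega)
  · exact natDegree_dotProduct_le hsd
      (fun _ => natDegree_dotProduct_le (fun _ => hD.N _ _) hd le_rfl) (by omega)
  · exact natDegree_mul_le_add (natDegree_dotProduct_le hsd hl le_rfl) hy (by omega)
  · exact natDegree_mul_le_add (natDegree_dotProduct_le hsl hd le_rfl) hy (by omega)
  · exact natDegree_mul_le_add (natDegree_dotProduct_le hsl (natDegree_phi hk hD hS) le_rfl) hy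
      (by omega)

theorem Delta2_eq (j : ℕ) : D.Delta2 k hk S j = (D.stepData hk Z y).Delta2.coeff j := by
  refine upTo_eq_coeff (fun j => ?_) (natDegree_Delta2 hk hD hS) j
  simp only [hS.coeff_Y, Nbarbar, nHat, Nc, L, d_eq hk hD hS, phi_eq hk hD hS, dotProduct, mulVec,
    Pi.star_apply, coeffMat_apply, ← coeff_star, add_mul, sub_mul, Finset.mul_sum, Finset.sum_mul,
    mul_assoc, sum3_add, sum3_sub, sum3_sum, sum2_sum, sum3_coeff, sum2_coeff,
    StepData.Delta2, coeff_add, coeff_sub, finsetSum_coeff]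
  rfl

theorem natDegree_V (i : Fin m) : ((D.stepData hk Z y).V i).natDegree ≤ D.bV k hk S := by
  have h1 : S.p ≤ D.qhat k S := le_max_left _ _
  have h2 : S.q + D.q ≤ D.qhat k S := le_max_right _ _
  have hd := natDegree_d hk hD hS
  have hsd := natDegree_star_apply_le hd
  have hl : ∀ x, ((D.stepData hk Z y).l x).natDegree ≤ D.nq := fun x => hD.N _ _
  have hsl := natDegree_star_apply_le hl
  have hy : (D.stepData hk Z y).y.natDegree ≤ S.p := hS.natDegree_Y
  have hZ : ∀ x, ((D.stepData hk Z y).Z x i).natDegree ≤ S.q := fun x => hS.natDegree_Z x i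
  have hsc := natDegree_star_apply_le (natDegree_c hk hD hS)
  have hΔ := natDegree_Delta1 hk hD hS
  rw [bV, StepData.V]
  by_cases hc : (D.stepData hk Z y).c = 0
  · rw [if_pos hc, if_neg (by simpa [cNonzero_iff hk hD hS] using hc)]
    refine natDegree_sub_le_max (natDegree_mul_le_add hΔ (b := S.q + D.qhat k S + D.nq) ?_
      (by omega)) ?_
    · exact natDegree_dotProduct_le
        (fun _ => natDegree_dotProduct_le hsd (fun _ => hD.N _ _) le_rfl) hZ (by omega)
    · exact natDegree_mul_le_add (natDegree_mul_le_add hΔ hy le_rfl)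
        (natDegree_dotProduct_le hsl hZ le_rfl) (by omega)
  · rw [if_neg hc, if_pos ((cNonzero_iff hk hD hS).mpr hc)]
    exact natDegree_mul_le_add hy (natDegree_dotProduct_le hsc (fun _ => hD.M _ _) le_rfl)
      (by omega)

theorem V_eq (j : ℕ) : D.V k hk S j = fun i => ((D.stepData hk Z y).V i).coeff j := by
  refine upTo_eq_coeffVec (fun j i => ?_) (natDegree_V hk hD hS) j
  rw [StepData.V]
  by_cases hc : (D.stepData hk Z y).c = 0
  · rw [if_pos hc, if_neg (by simpa [cNonzero_iff hk hD hS] using hc)]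
    simp only [sum3_apply, Pi.sub_apply, Pi.smul_apply, smul_eq_mul, vecMul, dotProduct,
      hS.coeff_Y, hS.coeff_Z, Nc, L, d_eq hk hD hS, Delta1_eq hk hD hS, Pi.star_apply,
      coeffMat_apply, ← coeff_star, Finset.mul_sum, Finset.sum_mul, mul_assoc, sum3_sub, sum3_sum,
      sum3_coeff_reverse, sum3_coeff_rotate, coeff_sub, finsetSum_coeff]
    rfl
  · rw [if_neg hc, if_pos ((cNonzero_iff hk hD hS).mpr hc)]
    simp only [sum2_apply, Pi.smul_apply, smul_eq_mul, vecMul, dotProduct,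
      hS.coeff_Y, Mc, c_eq hk hD hS, Pi.star_apply,
      coeffMat_apply, ← coeff_star, Finset.mul_sum, sum2_sum,
      sum2_coeff, finsetSum_coeff]
    rfl

theorem natDegree_W : (D.stepData hk Z y).W.natDegree ≤ D.bW k hk S := by
  have h1 : S.p ≤ D.qhat k S := le_max_left _ _
  have hy : (D.stepData hk Z y).y.natDegree ≤ S.p := hS.natDegree_Y
  have hc' := natDegree_c hk hD hS
  rw [bW, StepData.W]
  by_cases hc : (D.stepData hk Z y).c = 0
  · rw [if_pos hc, if_neg (by simpa [cNonzero_iff hk hD hS] using hc)]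
    exact natDegree_mul_le_add (natDegree_mul_le_add (natDegree_Delta2 hk hD hS) hy le_rfl) hy
      (by omega)
  · rw [if_neg hc, if_pos ((cNonzero_iff hk hD hS).mpr hc)]
    exact natDegree_dotProduct_le (natDegree_star_apply_le hc')
      (fun _ => natDegree_dotProduct_le (fun _ => hD.M _ _) hc' le_rfl) (by omega)

theorem W_eq (j : ℕ) : D.W k hk S j = (D.stepData hk Z y).W.coeff j := by
  refine upTo_eq_coeff (fun j => ?_) (natDegree_W hk hD hS) j
  rw [StepData.W]
  by_cases hc : (D.stepData hk Z y).c = 0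
  · rw [if_pos hc, if_neg (by simpa [cNonzero_iff hk hD hS] using hc)]
    simp only [hS.coeff_Y, Delta2_eq hk hD hS, mul_assoc, sum2_coeff]
    rfl
  · rw [if_neg hc, if_pos ((cNonzero_iff hk hD hS).mpr hc)]
    simp only [mulVec, dotProduct, Mc, c_eq hk hD hS, Pi.star_apply,
      coeffMat_apply, ← coeff_star, Finset.mul_sum, sum2_sum,
      sum2_coeff, finsetSum_coeff]
    rfl

theorem natDegree_Theta (r : Fin k) (c : Fin m) :
    ((D.stepData hk Z y).Theta r c).natDegree ≤ D.qNext k hk S := by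
  have h1 : S.p ≤ D.qhat k S := le_max_left _ _
  have h2 : S.q + D.q ≤ D.qhat k S := le_max_right _ _
  have hV := natDegree_V hk hD hS c
  rw [qNext]
  refine natDegree_sub_le_max (natDegree_sub_le_max ?_ ?_) ?_
  · exact natDegree_mul_le_add (natDegree_mul_le_add hD.Nden (natDegree_W hk hD hS) le_rfl)
      (hS.natDegree_Z _ _) (by omega)
  · exact natDegree_mul_le_add hD.Nden (natDegree_mul_le_add (natDegree_d hk hD hS r) hV le_rfl)
      (by omega)
  · exact natDegree_mul_le_add (natDegree_phi hk hD hS r) hV (by omega)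

theorem Theta_eq (j : ℕ) : D.Theta k hk S j = coeffMat (D.stepData hk Z y).Theta j := by
  refine upTo_eq_coeffMat (fun j r c => ?_) (natDegree_Theta hk hD hS) j
  have hs1 : ∀ f : ℕ → Matrix (Fin k) (Fin m) ℂ, sum1 j f r c = sum1 j fun κ => f κ r c :=
    fun f => by simp only [sum1, Matrix.sum_apply]
  have hs2 : ∀ f : ℕ → ℕ → Matrix (Fin k) (Fin m) ℂ,
      sum2 j f r c = sum2 j fun ρ κ => f ρ κ r c :=
    fun f => by simp only [sum2, Matrix.sum_apply]
  simp only [Matrix.sub_apply, hs1, hs2, Matrix.smul_apply, vecMulVec_apply, smul_eq_mul,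
    Nbarbar, hS.coeff_Z, coeffMat_apply, W_eq hk hD hS, V_eq hk hD hS, d_eq hk hD hS,
    phi_eq hk hD hS, mul_assoc, sum2_sub, sum2_coeff_right, sum2_coeff_mid, sum1_coeff,
    StepData.Theta, coeff_sub]
  rfl

/-- One step of the algorithm computes the coefficients of the fraction-free step: the convolutions
are the Cauchy products of the corresponding polynomials, and the truncations drop nothing. -/
theorem represents_next :
    (D.next k hk S).Represents (D.stepData hk Z y).nextZ (D.stepData hk Z y).nextY := by
  have h1 : S.p ≤ D.qhat k S := le_max_left _ _
  have hψ : (D.stepData hk Z y).psi.natDegree ≤ S.p + D.nden k :=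
    natDegree_mul_le_add hS.natDegree_Y hD.Nden le_rfl
  have hq : ∀ r c, ((D.stepData hk Z y).nextZ r c).natDegree ≤ D.qNext k hk S := by
    intro r c
    refine Fin.lastCases ?_ (fun r => ?_) r
    · have : (D.stepData hk Z y).nextZ (Fin.last k) c
          = (D.stepData hk Z y).psi * (D.stepData hk Z y).V c := by simp [StepData.nextZ]
      rw [this, qNext]
      exact natDegree_mul_le_add hψ (natDegree_V hk hD hS c) (by omega)
    · have : (D.stepData hk Z y).nextZ r.castSucc c = (D.stepData hk Z y).Theta r c := by
        simp [StepData.nextZ]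
      rw [this]
      exact natDegree_Theta hk hD hS r c
  have hp : (D.stepData hk Z y).nextY.natDegree ≤ D.pNext k hk S :=
    natDegree_mul_le_add hψ (natDegree_W hk hD hS) le_rfl
  refine ⟨?_, ?_, hq, hp⟩
  · refine upTo_eq_coeffMat (fun j r c => ?_) hq
    refine Fin.lastCases ?_ (fun r => ?_) r
    · simp [StepData.nextZ, appendRow, sum1_apply, psi_eq hk hS hD.Nden, V_eq hk hD hS, sum1_coeff]
    · simp [StepData.nextZ, appendRow, Theta_eq hk hD hS, coeffMat_apply]
  · refine upTo_eq_coeff (fun j => ?_) hp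
    simp only [psi_eq hk hS hD.Nden, W_eq hk hD hS, sum1_coeff]
    rfl

end Input
end Coefficients

/-! ### Positive definite polynomial matrices -/

noncomputable section Main

theorem algebraMap_star (p : ℂ[X]) :
    algebraMap ℂ[X] (RatFunc ℂ) (star p) = star (algebraMap ℂ[X] (RatFunc ℂ) p) :=
  (ratConj_algebraMap p).symm

theorem eval_star (p : ℂ[X]) (t : ℝ) : (star p).eval (t : ℂ) = star (p.eval (t : ℂ)) := by
  have h := Polynomial.eval_map_apply (p := p) (starRingEnd ℂ) (t : ℂ)
  rw [Complex.conj_ofReal] at h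
  exact h

/-- Polynomials that agree at infinitely many real points are equal. -/
theorem eq_of_infinite_real {p q : ℂ[X]} {s : Set ℝ} (hs : s.Infinite)
    (h : ∀ t ∈ s, p.eval (t : ℂ) = q.eval (t : ℂ)) : p = q := by
  refine Polynomial.eq_of_infinite_eval_eq p q
    ((hs.image Complex.ofReal_injective.injOn).mono ?_)
  rintro _ ⟨t, ht, rfl⟩
  exact h t ht

theorem IsPosDefPoly.conjTranspose_eq {k : ℕ} {P : Matrix (Fin k) (Fin k) ℂ[X]}
    (hP : IsPosDefPoly P) : Pᴴ = P := by
  ext1 i j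
  refine eq_of_infinite_real hP fun t ht => ?_
  rw [conjTranspose_apply, eval_star]
  exact ht.isHermitian.apply i j

theorem IsPosDefPoly.eq_zero_of_form {k : ℕ} {P : Matrix (Fin k) (Fin k) ℂ[X]}
    (hP : IsPosDefPoly P) (v : Fin k → ℂ[X]) (hv : star v ⬝ᵥ (P *ᵥ v) = 0) : v = 0 := by
  funext i
  refine eq_of_infinite_real hP fun t ht => ?_
  set f : ℂ[X] →+* ℂ := Polynomial.evalRingHom (t : ℂ) with hf
  have h1 : star (f ∘ v) ⬝ᵥ (P.map f *ᵥ (f ∘ v)) = 0 := by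
    rw [← StepData.comp_star f (fun p => eval_star p t), ← StepData.comp_mulVec,
      ← RingHom.map_dotProduct, hv, map_zero]
  have h2 : f ∘ v = 0 := by
    by_contra hne
    exact (ht.dotProduct_mulVec_pos hne).ne' h1
  simpa [hf] using congrFun h2 i

/-- Positive definiteness at infinitely many real points makes the form over `ℂ(s)` definite: a
polynomial vector on which the form vanishes is zero at infinitely many points. -/
theorem IsPosDefPoly.isDefiniteHermitian {k : ℕ} {P : Matrix (Fin k) (Fin k) ℂ[X]}
    (hP : IsPosDefPoly P) : IsDefiniteHermitian (toRat P) where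
  isHermitian := by
    conv_rhs => rw [← hP.conjTranspose_eq]
    ext1 i j
    exact (algebraMap_star _).symm
  eq_zero_of_form_eq_zero v hv := by
    -- A common denominator `b` reduces the claim to a polynomial vector `w = b v`.
    obtain ⟨b, hb⟩ := IsLocalization.exist_integer_multiples_of_finite (nonZeroDivisors ℂ[X]) v
    choose w hw using hb
    have hb0 : algebraMap ℂ[X] (RatFunc ℂ) b ≠ 0 := by simp
    have hwv : algebraMap ℂ[X] (RatFunc ℂ) ∘ w = algebraMap ℂ[X] (RatFunc ℂ) b • v := by
      funext i
      rw [Function.comp_apply, hw, Pi.smul_apply, Algebra.smul_def, smul_eq_mul]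
    have hw0 : w = 0 := by
      apply hP.eq_zero_of_form
      apply RatFunc.algebraMap_injective ℂ
      rw [RingHom.map_dotProduct, StepData.comp_star _ algebraMap_star, StepData.comp_mulVec, hwv,
        map_zero, star_smul, mulVec_smul, smul_dotProduct, dotProduct_smul]
      change _ • _ • (star v ⬝ᵥ (toRat P *ᵥ v)) = 0
      rw [hv, smul_zero, smul_zero]
    rw [hw0] at hwv
    funext i
    have := congrFun hwv i
    simpa [hb0] using this.symm

theorem IsPosDefPoly.leadPrincipal {n : ℕ} {P : Matrix (Fin n) (Fin n) ℂ[X]}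
    (hP : IsPosDefPoly P) (i : ℕ) (hi : i ≤ n) : IsPosDefPoly (leadPrincipal P i hi) := by
  refine Set.Infinite.mono (fun t ht => ?_) hP
  exact Matrix.PosDef.submatrix ht (Fin.castLE_injective hi)

/-! ### Correctness of all stages -/

variable {m n : ℕ}

theorem PenroseEqs.isTheWeightedMP {M : Matrix (Fin m) (Fin m) (RatFunc ℂ)}
    {N : Matrix (Fin n) (Fin n) (RatFunc ℂ)} {A : Matrix (Fin m) (Fin n) (RatFunc ℂ)}
    {X : Matrix (Fin n) (Fin m) (RatFunc ℂ)} (hM : IsDefiniteHermitian M)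
    (hN : IsDefiniteHermitian N) (h : PenroseEqs M N A X) : IsTheWeightedMP M N A X :=
  ⟨⟨h.eq_one, h.eq_two, h.eq_three, h.eq_four⟩, fun _ h' =>
    h.unique ⟨h'.eq_one, h'.eq_two, h'.eq_three, h'.eq_four⟩ hM.isHermitian
      (Matrix.nonsing_inv_mul _ hM.isUnit_det) hN.isHermitian
      (Matrix.nonsing_inv_mul _ hN.isUnit_det)⟩

/-- The stage `S` represents the weighted Moore-Penrose inverse of the first `i` columns, over a
denominator that is nonzero and has real coefficients.  Real coefficients are needed by the next
step, which uses the denominator in place of its conjugate. -/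
def Stage.IsCorrect (D : Input m n) {i : ℕ} (hi : i ≤ n) (S : Stage m i) : Prop :=
  ∃ (Z : Matrix (Fin i) (Fin m) ℂ[X]) (y : ℂ[X]), S.Represents Z y ∧ y ≠ 0 ∧ star y = y ∧
    PenroseEqs (toRat D.M) (toRat (leadPrincipal D.N i hi)) (toRat (leadCols D.A i hi))
      ((algebraMap ℂ[X] (RatFunc ℂ) y)⁻¹ • toRat Z)

namespace StepData

/-- A stage that represents the outcome of a polynomial step is correct if the step starts from a
weighted Moore-Penrose inverse of the first `k` columns.  The case `k = 0` is included. -/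
theorem isCorrect_next {D : Input m n} {k : ℕ} (hk : k < n) (T : StepData ℂ[X] (Fin m) k)
    {S : Stage m (k + 1)} (hS : S.Represents T.nextZ T.nextY)
    (hMpos : IsPosDefPoly D.M) (hNpos : IsPosDefPoly D.N)
    (hM : T.M = D.M) (hN : T.N = leadPrincipal D.N k hk.le) (hB : T.B = leadCols D.A k hk.le)
    (ha : T.a = fun r => D.A r ⟨k, hk⟩) (hl : T.l = fun r => D.N (Fin.castLE hk.le r) ⟨k, hk⟩)
    (hν : T.ν = D.N ⟨k, hk⟩ ⟨k, hk⟩)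
    (hy : T.y ≠ 0) (hys : star T.y = T.y) (hβ : T.β ≠ 0) (hβs : star T.β = T.β)
    (hinv : (toRat T.N)⁻¹ = (algebraMap ℂ[X] (RatFunc ℂ) T.β)⁻¹ • toRat T.Nb)
    (h : PenroseEqs (toRat T.M) (toRat T.N) (toRat T.B)
      ((algebraMap ℂ[X] (RatFunc ℂ) T.y)⁻¹ • toRat T.Z)) :
    S.IsCorrect D hk := by
  set f := algebraMap ℂ[X] (RatFunc ℂ)
  have hf : Function.Injective f := RatFunc.algebraMap_injective ℂ
  have hNk : IsDefiniteHermitian (toRat T.N) := by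
    rw [hN]; exact (hNpos.leadPrincipal k hk.le).isDefiniteHermitian
  have key := (T.map f).penroseEqs_next
    (N := toRat (leadPrincipal D.N (k + 1) hk)) (B := toRat (leadCols D.A (k + 1) hk))
    (by change IsDefiniteHermitian (toRat T.M); rw [hM]; exact hMpos.isDefiniteHermitian)
    (hNpos.leadPrincipal (k + 1) hk).isDefiniteHermitian
    (by change toRat T.N = _; rw [hN]; rfl) (by change toRat T.B = _; rw [hB]; rfl)
    (by change f ∘ T.a = _; rw [ha]; rfl) (by change f ∘ T.l = _; rw [hl]; rfl)
    (by change f T.ν = _; rw [hν]; rfl)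
    ((map_ne_zero_iff f hf).mpr hy) (by change star (f T.y) = f T.y; rw [← algebraMap_star, hys])
    ((map_ne_zero_iff f hf).mpr hβ) (by change star (f T.β) = f T.β; rw [← algebraMap_star, hβs])
    (by
      change toRat T.N * ((f T.β)⁻¹ • toRat T.Nb) = 1
      rw [← hinv, Matrix.mul_nonsing_inv _ hNk.isUnit_det])
    h
  rw [T.map_nextY f algebraMap_star hf, T.map_nextZ f algebraMap_star hf, ← algebraMap_star] at key
  obtain ⟨h1, h2, h3⟩ := key
  refine ⟨T.nextZ, T.nextY, hS, (map_ne_zero_iff f hf).mp h1, hf h2, ?_⟩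
  rw [← hM]
  exact h3

end StepData

namespace Input

theorem isCorrect_first_of_col_eq_zero {D : Input m n} (h : 0 < n)
    (ha : ∀ r, D.A r ⟨0, h⟩ = 0) : (D.first h).IsCorrect D h := by
  have hcol : ¬ ∃ j ≤ D.q, D.col 0 h j ≠ 0 := by
    rintro ⟨j, -, hj⟩
    exact hj (by ext r; simp [col, ha])
  have hA : toRat (leadCols D.A 1 h) = 0 := by
    ext1 r c
    have hc : Fin.castLE h c = ⟨0, h⟩ := Fin.ext (by simp)
    simp [toRat, leadCols, hc, ha r]
  refine ⟨0, 1, ⟨fun j => ?_, fun j => ?_, ?_, ?_⟩, one_ne_zero, star_one _, ?_⟩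
  · have hZ : (D.first h).Z = 0 := if_neg hcol
    rw [hZ]
    ext; simp [coeffMat]
  · have hY : (D.first h).Y = fun j => if j = 0 then 1 else 0 := if_neg hcol
    rw [hY, Polynomial.coeff_one]
  · simp
  · simp
  · have : toRat (0 : Matrix (Fin 1) (Fin m) ℂ[X]) = 0 := by ext; simp [toRat]
    constructor <;> simp [hA, this]

/-- The first stage as a step from the matrix with no columns.  The inverse of the empty matrix is
given the denominator `1`, since the input does not constrain its denominator of index `0`. -/
def firstStepData (D : Input m n) (h : 0 < n) : StepData ℂ[X] (Fin m) 0 :=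
  { D.stepData h 0 1 with β := 1 }

theorem firstStepData_c (D : Input m n) (h : 0 < n) :
    (D.firstStepData h).c = fun r => D.A r ⟨0, h⟩ := by
  ext1 r
  simp [firstStepData, StepData.c, stepData]

/-- A nonzero first column is linearly independent of the empty family, so that `y = β = 1` gives
`V = aᴴ M` and `W = aᴴ M a`. -/
theorem isCorrect_first_of_col_ne_zero {D : Input m n} (h : 0 < n)
    (hA : ∀ r c, (D.A r c).natDegree ≤ D.q) (hM : ∀ r c, (D.M r c).natDegree ≤ D.mq)
    (hMpos : IsPosDefPoly D.M) (hNpos : IsPosDefPoly D.N)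
    (ha : ¬ ∀ r, D.A r ⟨0, h⟩ = 0) : (D.first h).IsCorrect D h := by
  have hcol : ∃ j ≤ D.q, D.col 0 h j ≠ 0 := by
    by_contra hno
    refine ha fun r => Polynomial.ext fun j => ?_
    by_cases hj : j ≤ D.q
    · have h1 : D.col 0 h j = 0 := by
        by_contra h2
        exact hno ⟨j, hj, h2⟩
      simpa [col] using congrFun h1 r
    · exact coeff_eq_zero_of_natDegree_lt ((hA _ _).trans_lt (not_le.mp hj))
  set T := D.firstStepData h with hT
  set a : Fin m → ℂ[X] := fun r => D.A r ⟨0, h⟩ with ha'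
  have hc : T.c = a := D.firstStepData_c h
  have hc0 : T.c ≠ 0 := fun h0 => ha fun r => congrFun (hc.symm.trans h0) r
  have hda : ∀ r, (a r).natDegree ≤ D.q := fun r => hA _ _
  have hsa := natDegree_star_apply_le hda
  have hV : T.V = star a ᵥ* D.M := by
    rw [StepData.V, if_neg hc0, hc]
    exact one_smul _ _
  have hW : T.W = star a ⬝ᵥ (D.M *ᵥ a) := by
    rw [StepData.W, if_neg hc0, hc]
    rfl
  have hψ : T.psi = 1 := one_mul 1
  have hZ : ∀ (r : Fin 1) (c : Fin m), T.nextZ r c = (star a ᵥ* D.M) c := by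
    intro r c
    have hr : r = Fin.last 0 := Subsingleton.elim _ _
    rw [hr, StepData.nextZ, of_apply, Fin.snoc_last, hψ, one_smul, hV]
  have hY : T.nextY = star a ⬝ᵥ (D.M *ᵥ a) := by rw [StepData.nextY, hψ, one_mul, hW]
  have hdZ : ∀ r c, (T.nextZ r c).natDegree ≤ D.q + D.mq := fun r c => by
    rw [hZ]
    exact natDegree_dotProduct_le hsa (fun _ => hM _ _) le_rfl
  have hdY : T.nextY.natDegree ≤ 2 * D.q + D.mq := by
    rw [hY]
    exact natDegree_dotProduct_le hsa
      (fun _ => natDegree_dotProduct_le (fun _ => hM _ _) hda le_rfl) (by omega)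
  have hrep : (D.first h).Represents T.nextZ T.nextY := by
    refine ⟨fun j => ?_, fun j => ?_, hdZ, hdY⟩
    · have hZs : (D.first h).Z = upTo (D.q + D.mq) fun j =>
          Matrix.of fun _ => sum1 j fun k => star (D.col 0 h (j - k)) ᵥ* D.Mc k := if_pos hcol
      rw [hZs]
      refine upTo_eq_coeffMat (fun j r c => ?_) hdZ j
      rw [hZ]
      simp only [of_apply, sum1_apply, vecMul, dotProduct, Mc, col, Pi.star_apply, coeffMat_apply,
        ← coeff_star, sum1_sum, sum1_coeff, finsetSum_coeff]
      rfl
    · have hYs : (D.first h).Y = upTo (2 * D.q + D.mq) fun j => sum2 j fun r k =>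
          star (D.col 0 h (j - k - r)) ⬝ᵥ (D.Mc k *ᵥ D.col 0 h r) := if_pos hcol
      rw [hYs]
      refine upTo_eq_coeff (fun j => ?_) hdY j
      rw [hY]
      simp only [mulVec, dotProduct, Mc, col, Pi.star_apply, coeffMat_apply,
        ← coeff_star, Finset.mul_sum, sum2_sum, sum2_coeff, finsetSum_coeff]
      rfl
  refine T.isCorrect_next h hrep hMpos hNpos rfl rfl rfl rfl rfl rfl one_ne_zero (star_one _)
    one_ne_zero (star_one _) (Subsingleton.elim _ _) ?_
  refine ⟨?_, Subsingleton.elim _ _, ?_, Subsingleton.elim _ _⟩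
  · ext _ j; exact j.elim0
  · ext i j
    simp [Matrix.mul_apply]

theorem isCorrect_stage {D : Input m n}
    (hA : ∀ r c, (D.A r c).natDegree ≤ D.q) (hM : ∀ r c, (D.M r c).natDegree ≤ D.mq)
    (hN : ∀ r c, (D.N r c).natDegree ≤ D.nq) (hMpos : IsPosDefPoly D.M) (hNpos : IsPosDefPoly D.N)
    (hnum : ∀ k, 1 ≤ k → k < n → ∀ r c, (D.Nnum k r c).natDegree ≤ D.nnum k)
    (hden : ∀ k, 1 ≤ k → k < n → (D.Nden k).natDegree ≤ D.nden k)
    (hden0 : ∀ k, 1 ≤ k → k < n → D.Nden k ≠ 0)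
    (hdenReal : ∀ k, 1 ≤ k → k < n → ∀ j, ((D.Nden k).coeff j).im = 0)
    (hinv : ∀ k, 1 ≤ k → ∀ hk : k < n, (toRat (leadPrincipal D.N k hk.le))⁻¹ =
        (algebraMap (Polynomial ℂ) (RatFunc ℂ) (D.Nden k))⁻¹ • toRat (D.Nnum k))
    (i : ℕ) (h1 : 1 ≤ i) (hi : i ≤ n) : (D.stage i hi).IsCorrect D hi := by
  induction i, h1 using Nat.le_induction with
  | base =>
    change (D.first hi).IsCorrect D hi
    by_cases ha : ∀ r, D.A r ⟨0, hi⟩ = 0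
    · exact isCorrect_first_of_col_eq_zero hi ha
    · exact isCorrect_first_of_col_ne_zero hi hA hM hMpos hNpos ha
  | succ k hk ih =>
    -- `stage` unfolds only at an index of the form `k + 2`.
    obtain ⟨k, rfl⟩ : ∃ l, k = l + 1 := ⟨k - 1, by omega⟩
    obtain ⟨Z, y, hS, hy, hys, hP⟩ := ih (Nat.le_of_succ_le hi)
    have hD : D.DegreeBounds (k + 1) := ⟨hA, hM, hN, hnum _ hk hi, hden _ hk hi⟩
    change (D.next (k + 1) hi (D.stage (k + 1) (Nat.le_of_succ_le hi))).IsCorrect D hi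
    refine (D.stepData hi Z y).isCorrect_next hi (represents_next hi hD hS) hMpos hNpos
      rfl rfl rfl rfl rfl rfl hy hys (hden0 _ hk hi) ?_ (hinv _ hk hi) hP
    refine Polynomial.ext fun j => ?_
    rw [coeff_star]
    exact Complex.conj_eq_iff_im.mpr (hdenReal _ hk hi j)

end Input

theorem Stage.IsCorrect.isTheWeightedMP {D : Input m n} {i : ℕ} {hi : i ≤ n} {S : Stage m i}
    (hMpos : IsPosDefPoly D.M) (hNpos : IsPosDefPoly D.N) (h : S.IsCorrect D hi) :
    S.den ≠ 0 ∧ IsTheWeightedMP (toRat D.M) (toRat (leadPrincipal D.N i hi))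
      (toRat (leadCols D.A i hi)) S.quotient := by
  obtain ⟨Z, y, hS, hy, -, hP⟩ := h
  rw [Stage.quotient, hS.den_eq, hS.num_eq]
  exact ⟨hy, hP.isTheWeightedMP hMpos.isDefiniteHermitian
    (hNpos.leadPrincipal i hi).isDefiniteHermitian⟩

end Main
end WeightedMP

theorem theorem3p1 (m n : ℕ) (hn : 1 ≤ n) (D : WeightedMP.Input m n)
    -- `A`, `M`, `N` have degrees at most `q`, `mq`, `nq`
    (hA : ∀ r c, (D.A r c).natDegree ≤ D.q)
    (hM : ∀ r c, (D.M r c).natDegree ≤ D.mq)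
    (hN : ∀ r c, (D.N r c).natDegree ≤ D.nq)
    -- `M` and `N` are positive definite
    (hMpos : WeightedMP.IsPosDefPoly D.M)
    (hNpos : WeightedMP.IsPosDefPoly D.N)
    -- for `1 ≤ k < n`, the inverse of the leading principal submatrix of order `k` of `N`
    -- is given as a polynomial matrix over a polynomial with real coefficients
    (hnum : ∀ k, 1 ≤ k → k < n → ∀ r c, (D.Nnum k r c).natDegree ≤ D.nnum k)
    (hden : ∀ k, 1 ≤ k → k < n → (D.Nden k).natDegree ≤ D.nden k)
    (hden0 : ∀ k, 1 ≤ k → k < n → D.Nden k ≠ 0)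
    (hdenReal : ∀ k, 1 ≤ k → k < n → ∀ j, ((D.Nden k).coeff j).im = 0)
    (hinv : ∀ k, 1 ≤ k → ∀ hk : k < n,
      (WeightedMP.toRat (WeightedMP.leadPrincipal D.N k hk.le))⁻¹ =
        (algebraMap (Polynomial ℂ) (RatFunc ℂ) (D.Nden k))⁻¹ • WeightedMP.toRat (D.Nnum k)) :
    -- every stage represents the weighted Moore-Penrose inverse of the first `i` columns
    (∀ i, 1 ≤ i → ∀ hi : i ≤ n,
      (D.stage i hi).den ≠ 0 ∧
      WeightedMP.IsTheWeightedMP (WeightedMP.toRat D.M)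
        (WeightedMP.toRat (WeightedMP.leadPrincipal D.N i hi))
        (WeightedMP.toRat (WeightedMP.leadCols D.A i hi))
        (D.stage i hi).quotient) ∧
    -- the output is the weighted Moore-Penrose inverse of `A`
    WeightedMP.IsTheWeightedMP (WeightedMP.toRat D.M) (WeightedMP.toRat D.N)
      (WeightedMP.toRat D.A) (D.stage n le_rfl).quotient := by
  have h : ∀ i, 1 ≤ i → ∀ hi : i ≤ n, _ := fun i h1 hi =>
    (WeightedMP.Input.isCorrect_stage hA hM hN hMpos hNpos hnum hden hden0 hdenReal hinv
      i h1 hi).isTheWeightedMP hMpos hNpos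
  exact ⟨h, (h n hn le_rfl).2⟩
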